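/- All manifolds are finite-dimensional, Hausdorff, $\sigma$-compact, smooth and without boundary; vector bundles are smooth, real and of finite constant rank. A \emph{Lie algebroid} over $M$ is a vector bundle $E\to M$ with a smooth bundle map $a\colon E\to TM$ over $\mathrm{id}_M$ and an $\mathbb{R}$-bilinear Lie bracket on its space of sections $\Gamma(E)$ such that $[\sigma,f\tau]=f[\sigma,\tau]+(a(\sigma)f)\,\tau$ for $\sigma,\tau\in\Gamma(E)$, $f\in C^\infty(M)$. A \emph{Poisson structure} on a manifold $N$ is an $\mathbb{R}$-bilinear skew-symmetric bracket on $C^\infty(N)$ satisfying the Leibniz rule and the Jacobi identity; its bivector field $\pi$ is given by $\pi(df,dg)=\{f,g\}$. For a vector bundle $V$ let $\kappa_t\colon V\to V$ be scalar multiplication by $t$; a Poisson structure on the total space of $V$ is \emph{(fiberwise) linear} if $\kappa_t^*\pi=t^{-1}\pi$ for all $t\neq 0$. A section $\sigma$ of $E$ defines the function $\phi_\sigma(\xi)=\langle \xi,\sigma(x)\rangle$ $(\xi\in E^*_x)$ on the total space of $E^*$; likewise a section $\sigma$ of $V^*$ defines the function $\phi_\sigma(v)=\langle\sigma(x),v\rangle$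 $(v\in V_x)$ on the total space of $V=(V^*)^*$. \textbf{Theorem.} (a) Let $E\to M$ be a Lie algebroid. There is a fiberwise linear Poisson structure on the total space of $E^*$ such that $$\{\phi_\sigma,\phi_\tau\}=\phi_{[\sigma,\tau]}\qquad\text{for all }\sigma,\tau\in\Gamma(E),\tag{1}$$ and it is the only fiberwise linear Poisson structure with this property. If $\operatorname{rank}E\ge 1$ or $\dim M\le 1$, it is the only Poisson structure on $E^*$ (linear or not) satisfying (1). (b) Conversely, for every vector bundle $V\to M$ and every fiberwise linear Poisson structure $\{\cdot,\cdot\}$ on the total space of $V$ there is a unique Lie algebroid structure on the dual bundle $V^*$ such that $\{\phi_\sigma,\phi_\tau\}=\phi_{[\sigma,\tau]}$ for all $\sigma,\tau\in\Gamma(V^*)$. -/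

import Mathlib

open Bundle Module
open scoped Manifold ContDiff Bundle

noncomputable section

/-! ### Multivector fields and Poisson structures on a manifold -/

section Poisson

variable {EN : Type*} [NormedAddCommGroup EN] [NormedSpace ℝ EN]
  {HN : Type*} [TopologicalSpace HN] (J : ModelWithCorners ℝ EN HN)
  {N : Type*} [TopologicalSpace N] [ChartedSpace HN N]

/-- The cotangent space `T*_x N`. -/
abbrev CotangentSpace (x : N) : Type _ := TangentSpace J x →L[ℝ] ℝ

/-- The differential `d_x f` of a smooth function, as an element of `T*_x N`. -/
def differential (f : C^∞⟮J, N; 𝓘(ℝ), ℝ⟯) (x : N) : CotangentSpace J x :=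
  mvfderiv J (f : N → ℝ) x

variable (N) in
/-- Fields of `k`-vectors on `N`: an element of `⋀ᵏ T_x N` is regarded as an alternating `k`-linear
form on `T*_x N`. No smoothness is built into this type; the bivector field of a Poisson structure
is smooth because the Poisson bracket of two smooth functions is smooth. -/
abbrev MultivectorField (k : ℕ) : Type _ := ∀ x : N, CotangentSpace J x [⋀^Fin k]→ₗ[ℝ] ℝ

/-- The pull-back `κ^* u` of a `k`-vector field `u` under a diffeomorphism `κ : N → N`:
`(κ^* u)_x (α₁, …, α_k) = u_{κ x} (α₁ ∘ (T_x κ)⁻¹, …, α_k ∘ (T_x κ)⁻¹)`. -/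
def MultivectorField.pullback {k : ℕ} (κ : N → N) (u : MultivectorField J N k) :
    MultivectorField J N k := fun x ↦
  (u (κ x)).compLinearMap
    { toFun := fun α : CotangentSpace J x ↦
        (α.comp (mfderiv J J κ x).inverse : CotangentSpace J (κ x))
      map_add' := fun α β ↦ ContinuousLinearMap.add_comp α β _
      map_smul' := fun c α ↦ ContinuousLinearMap.smul_comp c α _ }

variable (N) in
/-- A Poisson structure on `N`: an `ℝ`-bilinear, skew-symmetric bracket on `C^∞(N)` which is
a derivation in the second argument and satisfies the Jacobi identity. -/
@[ext]
structure PoissonStructure where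
  /-- the Poisson bracket `{f, g}` -/
  bracket : C^∞⟮J, N; 𝓘(ℝ), ℝ⟯ →ₗ[ℝ] C^∞⟮J, N; 𝓘(ℝ), ℝ⟯ →ₗ[ℝ] C^∞⟮J, N; 𝓘(ℝ), ℝ⟯
  skew : ∀ f g, bracket f g = -bracket g f
  leibniz : ∀ f g h, bracket f (g * h) = bracket f g * h + g * bracket f h
  jacobi : ∀ f g h, bracket f (bracket g h) = bracket (bracket f g) h + bracket g (bracket f h)

/-- `u` is the bivector field `π` of the Poisson structure `P`, that is `π(df, dg) = {f, g}`. -/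
def PoissonStructure.HasBivector (P : PoissonStructure J N) (u : MultivectorField J N 2) : Prop :=
  ∀ (f g : C^∞⟮J, N; 𝓘(ℝ), ℝ⟯) (x : N),
    u x ![differential J f x, differential J g x] = P.bracket f g x

end Poisson

/-! ### Vector bundles, Lie algebroids and fiberwise linear Poisson structures -/

section VectorBundle

variable {EM : Type*} [NormedAddCommGroup EM] [NormedSpace ℝ EM]
  {HM : Type*} [TopologicalSpace HM] (I : ModelWithCorners ℝ EM HM)
  {M : Type*} [TopologicalSpace M] [ChartedSpace HM M]
  (F : Type*) [NormedAddCommGroup F] [NormedSpace ℝ F]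
  (E : M → Type*) [TopologicalSpace (TotalSpace F E)]
  [∀ x, AddCommGroup (E x)] [∀ x, Module ℝ (E x)] [∀ x, TopologicalSpace (E x)]
  [FiberBundle F E] [VectorBundle ℝ F E]

variable {E} in
/-- Scalar multiplication `κ_t` by `t` on the total space of a vector bundle. -/
def fiberScaling (t : ℝ) : TotalSpace F E → TotalSpace F E := fun v ↦ ⟨v.proj, t • v.2⟩

variable {F E} in
/-- A `k`-vector field `u` on the total space of a vector bundle is (fiberwise) linear if it is
homogeneous of degree `1 - k`, that is `κ_t^* u = t ^ (1 - k) • u` for all `t ≠ 0`. -/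
def MultivectorField.IsFiberwiseLinear {k : ℕ}
    (u : MultivectorField (I.prod 𝓘(ℝ, F)) (TotalSpace F E) k) : Prop :=
  ∀ t : ℝ, t ≠ 0 →
    MultivectorField.pullback (I.prod 𝓘(ℝ, F)) (fiberScaling F t) u = (t ^ (1 - (k : ℤ))) • u

variable {F E} in
/-- A Poisson structure on the total space of a vector bundle is (fiberwise) linear if its
bivector field is. -/
def PoissonStructure.IsFiberwiseLinear
    (P : PoissonStructure (I.prod 𝓘(ℝ, F)) (TotalSpace F E)) : Prop :=
  ∃ u : MultivectorField (I.prod 𝓘(ℝ, F)) (TotalSpace F E) 2,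
    PoissonStructure.HasBivector (I.prod 𝓘(ℝ, F)) P u ∧
      MultivectorField.IsFiberwiseLinear I u

variable {I F E} in
/-- The product `f σ` of a smooth function and a smooth section. -/
def ContMDiffSection.funSMul (f : C^∞⟮I, M; 𝓘(ℝ), ℝ⟯) (σ : Cₛ^∞⟮I; F, E⟯) : Cₛ^∞⟮I; F, E⟯ where
  toFun x := f x • σ x
  contMDiff_toFun := f.contMDiff.smul_section σ.contMDiff

/-- A Lie algebroid structure on the vector bundle `E → M`: a Lie bracket on the space `Γ(E)` of
smooth sections and a smooth bundle map `a : E → TM` (the anchor), such that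
`[σ, f τ] = f [σ, τ] + (a(σ) f) τ`. -/
@[ext]
structure LieAlgebroidStructure [IsManifold I ∞ M] where
  /-- the Lie bracket on `Γ(E)` -/
  bracket : Cₛ^∞⟮I; F, E⟯ →ₗ[ℝ] Cₛ^∞⟮I; F, E⟯ →ₗ[ℝ] Cₛ^∞⟮I; F, E⟯
  /-- the anchor, as a smooth section of `Hom(E, TM)` -/
  anchor : Cₛ^∞⟮I; F →L[ℝ] EM, fun x ↦ E x →L[ℝ] TangentSpace I x⟯
  bracket_self : ∀ σ, bracket σ σ = 0
  jacobi : ∀ σ τ ρ,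
    bracket σ (bracket τ ρ) = bracket (bracket σ τ) ρ + bracket τ (bracket σ ρ)
  leibniz : ∀ (σ τ : Cₛ^∞⟮I; F, E⟯) (f : C^∞⟮I, M; 𝓘(ℝ), ℝ⟯) (x : M),
    bracket σ (ContMDiffSection.funSMul f τ) x =
      f x • bracket σ τ x + differential I f x (anchor x (σ x)) • τ x

/-- The dual bundle `E*`, with fibers `E* x = (E x)*`; its model fiber is `F →L[ℝ] ℝ`. -/
abbrev DualBundle : M → Type _ := fun x ↦ E x →L[ℝ] Bundle.Trivial M ℝ x

variable {I F E}

/-- The linear function `φ_σ` on the total space of `E*` defined by a section `σ` of `E`: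
`φ_σ(ξ) = ⟨ξ, σ(x)⟩` for `ξ ∈ E* x`. -/
def linearFunction [ContMDiffVectorBundle ∞ F E I] (σ : Cₛ^∞⟮I; F, E⟯) :
    C^∞⟮I.prod 𝓘(ℝ, F →L[ℝ] ℝ), TotalSpace (F →L[ℝ] ℝ) (DualBundle E); 𝓘(ℝ), ℝ⟯ where
  val ξ := ξ.2 (σ ξ.proj)
  property := by
    have h : ContMDiff (I.prod 𝓘(ℝ, F →L[ℝ] ℝ)) (I.prod 𝓘(ℝ, ℝ)) ∞
        (fun ξ : TotalSpace (F →L[ℝ] ℝ) (DualBundle E) ↦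
          TotalSpace.mk' ℝ (E := Bundle.Trivial M ℝ) ξ.proj (ξ.2 (σ ξ.proj))) :=
      ContMDiff.clm_bundle_apply (F₁ := F) (F₂ := ℝ) contMDiff_id
        (σ.contMDiff.comp (contMDiff_proj (DualBundle E)))
    exact fun ξ ↦ (contMDiffAt_totalSpace.1 (h ξ)).2

/-- The linear function `φ_σ` on the total space of `E` defined by a section `σ` of `E*`:
`φ_σ(v) = ⟨σ(x), v⟩` for `v ∈ E x`. This is the linear function on `(E*)*` defined by the section
`σ` of `E*`, read through the canonical identification `E = (E*)*`. -/
def linearFunctionOfDual [ContMDiffVectorBundle ∞ F E I]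
    (σ : Cₛ^∞⟮I; F →L[ℝ] ℝ, DualBundle E⟯) :
    C^∞⟮I.prod 𝓘(ℝ, F), TotalSpace F E; 𝓘(ℝ), ℝ⟯ where
  val v := σ v.proj v.2
  property := by
    have h : ContMDiff (I.prod 𝓘(ℝ, F)) (I.prod 𝓘(ℝ, ℝ)) ∞
        (fun v : TotalSpace F E ↦
          TotalSpace.mk' ℝ (E := Bundle.Trivial M ℝ) v.proj (σ v.proj v.2)) :=
      ContMDiff.clm_bundle_apply (F₁ := F) (F₂ := ℝ)
        (σ.contMDiff.comp (contMDiff_proj E)) contMDiff_id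
    exact fun v ↦ (contMDiffAt_totalSpace.1 (h v)).2

/-- The relation `{φ_σ, φ_τ} = φ_[σ,τ]` on `E*`, for a Lie algebroid `E`. -/
def LieAlgebroidStructure.Induces [IsManifold I ∞ M] [ContMDiffVectorBundle ∞ F E I]
    (A : LieAlgebroidStructure I F E)
    (P : PoissonStructure (I.prod 𝓘(ℝ, F →L[ℝ] ℝ)) (TotalSpace (F →L[ℝ] ℝ) (DualBundle E))) :
    Prop :=
  ∀ σ τ : Cₛ^∞⟮I; F, E⟯,
    P.bracket (linearFunction σ) (linearFunction τ) = linearFunction (A.bracket σ τ)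

/-- The relation `{φ_σ, φ_τ} = φ_[σ,τ]` on `E = (E*)*`, for a Lie algebroid `E*`. -/
def LieAlgebroidStructure.InducesOnPredual [IsManifold I ∞ M] [ContMDiffVectorBundle ∞ F E I]
    (A : LieAlgebroidStructure I (F →L[ℝ] ℝ) (DualBundle E))
    (P : PoissonStructure (I.prod 𝓘(ℝ, F)) (TotalSpace F E)) : Prop :=
  ∀ σ τ : Cₛ^∞⟮I; F →L[ℝ] ℝ, DualBundle E⟯,
    P.bracket (linearFunctionOfDual σ) (linearFunctionOfDual τ) =
      linearFunctionOfDual (A.bracket σ τ)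

end VectorBundle

end

/-!
The differentials of the affine functions `φ_σ + u ∘ p` exhaust the cotangent spaces of the total
space of `E*`, so a Poisson structure there amounts to its values on these functions, and the Jacobi
identity may be tested on them. For the linear Poisson structure they form the semidirect product of
`Γ(E)`, acting through the anchor, with the abelian Lie algebra `C^∞(M)`. This bracket of affine
functions descends to cotangent vectors: if `d(φ_σ + u ∘ p)` vanishes at `ξ`, in the fibre over `x`,
then `σ(x) = 0`, and the Leibniz rule of the Lie algebroid expresses `⟨ξ, [τ, σ](x)⟩` through the
differential of `⟨s, σ⟩` at `x`, where `s` is a section of `E*` through `ξ`; this differential is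
`-du`.

Conversely, comparing the two Leibniz rules in `{φ_σ, φ_(f τ)} = φ_[σ, f τ]` and cancelling `φ_τ`
forces `{φ_σ, f ∘ p} = (a(σ) f) ∘ p`, and then, in positive rank, `{f ∘ p, g ∘ p} = 0`. For a linear
Poisson structure the latter holds since the bracket has degree `-1` under `κ_t`, and a smooth
function of negative degree is zero.

The same degree count yields the Lie algebroid of a linear Poisson structure: `{φ_σ, φ_τ}` has
degree one, hence comes from a section, and `{φ_σ, f ∘ p}` has degree zero, hence is the pull-back
of a function on the base that is a derivation in `f` and `C^∞(M)`-linear in `σ`, hence an anchor.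
-/

noncomputable section

open Set Filter Topology

section Calculus

universe u

variable {X : Type u} [NormedAddCommGroup X] [NormedSpace ℝ X]

theorem hasFDerivAt_intervalIntegral_of_contDiff [ProperSpace X] {G : Type*}
    [NormedAddCommGroup G] [NormedSpace ℝ G] {f : X × ℝ → G} (hf : ContDiff ℝ 1 f)
    (a b : ℝ) (y : X) :
    HasFDerivAt (fun y ↦ ∫ t in a..b, f (y, t))
      (∫ t in a..b, (fderiv ℝ f (y, t)).comp (.inl ℝ X ℝ)) y := by
  have hf' : Continuous fun p ↦ (fderiv ℝ f p).comp (.inl ℝ X ℝ) :=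
    (hf.continuous_fderiv one_ne_zero).clm_comp continuous_const
  obtain ⟨C, hC⟩ := ((isCompact_closedBall y 1).prod
    (isCompact_uIcc (a := a) (b := b))).exists_bound_of_continuousOn hf'.continuousOn
  refine intervalIntegral.hasFDerivAt_integral_of_dominated_of_fderiv_le
    (F' := fun z t ↦ (fderiv ℝ f (z, t)).comp (.inl ℝ X ℝ)) (bound := fun _ ↦ C)
    (Metric.closedBall_mem_nhds y one_pos) ?_ ?_ ?_ ?_ ?_ ?_
  · exact .of_forall fun z ↦ (hf.continuous.comp (.prodMk_right z)).aestronglyMeasurable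
  · exact (hf.continuous.comp (.prodMk_right y)).intervalIntegrable _ _
  · exact (hf'.comp (.prodMk_right y)).aestronglyMeasurable
  · exact .of_forall fun t ht z hz ↦ hC (z, t) ⟨hz, uIoc_subset_uIcc ht⟩
  · exact intervalIntegrable_const
  · exact .of_forall fun t _ z _ ↦
      (hf.differentiable one_ne_zero (z, t)).hasFDerivAt.comp z (hasFDerivAt_prodMk_left z t)

theorem contDiff_intervalIntegral_of_contDiff [ProperSpace X] {G : Type u}
    [NormedAddCommGroup G] [NormedSpace ℝ G] {n : ℕ} {f : X × ℝ → G} (hf : ContDiff ℝ n f)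
    (a b : ℝ) : ContDiff ℝ n fun y ↦ ∫ t in a..b, f (y, t) := by
  induction n generalizing G with
  | zero =>
    rw [Nat.cast_zero, contDiff_zero] at hf ⊢
    exact intervalIntegral.continuous_parametric_intervalIntegral_of_continuous'
      (f := fun y t ↦ f (y, t)) hf a b
  | succ n ih =>
    have hderiv (y : X) := hasFDerivAt_intervalIntegral_of_contDiff
      (hf.of_le (by exact_mod_cast Nat.le_add_left 1 n)) a b y
    rw [Nat.cast_add, Nat.cast_one, contDiff_succ_iff_fderiv]
    refine ⟨fun y ↦ (hderiv y).differentiableAt, fun h ↦ by simp at h, ?_⟩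
    rw [funext fun y ↦ (hderiv y).fderiv]
    exact ih ((hf.fderiv_right (by norm_cast)).clm_comp contDiff_const)

/- Hadamard's lemma; `g y` is the average of `fderiv ℝ f` over the segment from `y₀` to `y`. -/
theorem exists_contDiff_eq_add_apply_sub [FiniteDimensional ℝ X] {f : X → ℝ}
    (hf : ContDiff ℝ ∞ f) (y₀ : X) :
    ∃ g : X → X →L[ℝ] ℝ, ContDiff ℝ ∞ g ∧ g y₀ = fderiv ℝ f y₀ ∧
      ∀ y, f y = f y₀ + g y (y - y₀) := by
  have : ProperSpace X := FiniteDimensional.proper ℝ X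
  have hf' : ContDiff ℝ ∞ fun p : X × ℝ ↦ fderiv ℝ f (y₀ + p.2 • (p.1 - y₀)) :=
    (hf.fderiv_right (m := ∞) (by simp)).comp (by fun_prop)
  refine ⟨fun y ↦ ∫ t in (0 : ℝ)..1, fderiv ℝ f (y₀ + t • (y - y₀)), ?_, by simp, fun y ↦ ?_⟩
  · exact contDiff_infty.2 fun n ↦ contDiff_intervalIntegral_of_contDiff
      (hf'.of_le (by exact_mod_cast le_top)) 0 1
  · have hcont : Continuous fun t : ℝ ↦ fderiv ℝ f (y₀ + t • (y - y₀)) :=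
      hf'.continuous.comp (.prodMk_right y)
    have hline (t : ℝ) : HasDerivAt (fun t : ℝ ↦ f (y₀ + t • (y - y₀)))
        (fderiv ℝ f (y₀ + t • (y - y₀)) (y - y₀)) t := by
      have hseg : HasDerivAt (fun t : ℝ ↦ y₀ + t • (y - y₀)) (y - y₀) t := by
        simpa using ((hasDerivAt_id t).smul_const (y - y₀)).const_add y₀
      exact (hf.differentiable (by simp) _).hasFDerivAt.comp_hasDerivAt t hseg
    beta_reduce
    rw [ContinuousLinearMap.intervalIntegral_apply (hcont.intervalIntegrable _ _),
      intervalIntegral.integral_eq_sub_of_hasDerivAt (fun t _ ↦ hline t)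
        ((hcont.clm_apply continuous_const).intervalIntegrable _ _)]
    simp

theorem exists_contDiffAt_eq_sum_smul {X V ι : Type*} [NormedAddCommGroup X] [NormedSpace ℝ X]
    [NormedAddCommGroup V] [NormedSpace ℝ V] [Fintype ι]
    {n : WithTop ℕ∞} {x : X} (b : Basis ι ℝ V) {l : ι → X → V} (hb : ∀ i, l i x = b i)
    (hl : ∀ i, ContDiffAt ℝ n (l i) x) {f : X → V} (hf : ContDiffAt ℝ n f x) :
    ∃ c : X → ι → ℝ, ContDiffAt ℝ n c x ∧ ∀ᶠ y in 𝓝 x, f y = ∑ i, c y i • l i y := by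
  have : FiniteDimensional ℝ V := .of_basis b
  let L (y : X) : (ι → ℝ) →L[ℝ] V :=
    ∑ i, (ContinuousLinearMap.proj (R := ℝ) (φ := fun _ : ι ↦ ℝ) i).smulRight (l i y)
  have hL_apply (y : X) (v : ι → ℝ) : L y v = ∑ i, v i • l i y := by simp [L]
  let e : (ι → ℝ) ≃L[ℝ] V := b.equivFun.symm.toContinuousLinearEquiv
  have hLx : L x = e := by
    ext1 v
    simp only [hL_apply, hb]
    exact (b.equivFun_symm_apply v).symm
  have hL : ContDiffAt ℝ n L x :=
    ContDiffAt.sum fun i _ ↦ contDiffAt_const.smulRight (hl i)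
  have hinv : ContDiffAt ℝ n ContinuousLinearMap.inverse (L x) := hLx ▸ contDiffAt_map_inverse e
  refine ⟨fun y ↦ (L y).inverse (f y), (hinv.comp x hL).clm_apply hf, ?_⟩
  have hequiv : range ((↑) : ((ι → ℝ) ≃L[ℝ] V) → _) ∈ 𝓝 (L x) := hLx ▸ e.nhds
  filter_upwards [hL.continuousAt.eventually hequiv] with y ⟨e', he'⟩
  rw [← hL_apply, ← he', ContinuousLinearMap.inverse_equiv]
  exact (e'.apply_symm_apply _).symm

end Calculus

section SmoothFunctions

variable {EN : Type*} [NormedAddCommGroup EN] [NormedSpace ℝ EN]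
  {HN : Type*} [TopologicalSpace HN] {J : ModelWithCorners ℝ EN HN}
  {N : Type*} [TopologicalSpace N] [ChartedSpace HN N]

theorem contMDiffMap_sum_apply {ι : Type*} (s : Finset ι) (f : ι → C^∞⟮J, N; 𝓘(ℝ), ℝ⟯) (x : N) :
    (∑ i ∈ s, f i) x = ∑ i ∈ s, f i x :=
  map_sum (ContMDiffMap.evalRingHom (I := J) (n := ∞) (R := ℝ) x) f s

theorem mdifferentiableAt_contMDiffMap (f : C^∞⟮J, N; 𝓘(ℝ), ℝ⟯) (x : N) :
    MDifferentiableAt J 𝓘(ℝ) f x :=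
  f.contMDiff.mdifferentiable (by simp) x

theorem differential_add (f g : C^∞⟮J, N; 𝓘(ℝ), ℝ⟯) (x : N) :
    differential J (f + g) x = differential J f x + differential J g x :=
  mvfderiv_add (mdifferentiableAt_contMDiffMap f x) (mdifferentiableAt_contMDiffMap g x)

theorem differential_mul (f g : C^∞⟮J, N; 𝓘(ℝ), ℝ⟯) (x : N) :
    differential J (f * g) x = f x • differential J g x + g x • differential J f x :=
  mvfderiv_mul (mdifferentiableAt_contMDiffMap f x) (mdifferentiableAt_contMDiffMap g x)

theorem differential_const (c : ℝ) (x : N) :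
    differential J (ContMDiffMap.const c : C^∞⟮J, N; 𝓘(ℝ), ℝ⟯) x = 0 :=
  mvfderiv_const c

theorem differential_smul (c : ℝ) (f : C^∞⟮J, N; 𝓘(ℝ), ℝ⟯) (x : N) :
    differential J (c • f) x = c • differential J f x := by
  have h := differential_mul (ContMDiffMap.const c) f x
  rwa [differential_const, smul_zero, add_zero] at h

variable (J) in
/-- The differential at `x`, as a linear map on smooth functions. -/
def differentialₗ (x : N) : C^∞⟮J, N; 𝓘(ℝ), ℝ⟯ →ₗ[ℝ] CotangentSpace J x where
  toFun f := differential J f x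
  map_add' f g := differential_add f g x
  map_smul' c f := differential_smul c f x

theorem differential_sub (f g : C^∞⟮J, N; 𝓘(ℝ), ℝ⟯) (x : N) :
    differential J (f - g) x = differential J f x - differential J g x :=
  (differentialₗ J x).map_sub f g

theorem differential_sum {ι : Type*} (s : Finset ι) (f : ι → C^∞⟮J, N; 𝓘(ℝ), ℝ⟯) (x : N) :
    differential J (∑ i ∈ s, f i) x = ∑ i ∈ s, differential J (f i) x :=
  map_sum (differentialₗ J x) f s

theorem differential_comp {EN' : Type*} [NormedAddCommGroup EN'] [NormedSpace ℝ EN']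
    {HN' : Type*} [TopologicalSpace HN'] {J' : ModelWithCorners ℝ EN' HN'}
    {N' : Type*} [TopologicalSpace N'] [ChartedSpace HN' N']
    (f : C^∞⟮J, N; 𝓘(ℝ), ℝ⟯) (k : C^∞⟮J', N'; J, N⟯) (x : N') :
    differential J' (f.comp k) x = (differential J f (k x)).comp (mfderiv J' J k x) :=
  mvfderiv_comp x (mdifferentiableAt_contMDiffMap f _) (k.contMDiff.mdifferentiable (by simp) x)

theorem exists_contMDiffMap_eq_mul {χ : C^∞⟮J, N; 𝓘(ℝ), ℝ⟯} {s : Set N} (hs : IsOpen s)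
    (hχ : tsupport χ ⊆ s) {g : N → ℝ} (hg : ContMDiffOn J 𝓘(ℝ) ∞ g s) :
    ∃ h : C^∞⟮J, N; 𝓘(ℝ), ℝ⟯, ∀ y, h y = χ y * g y := by
  refine ⟨⟨fun y ↦ χ y * g y, contMDiff_of_tsupport fun y hy ↦ ?_⟩, fun y ↦ rfl⟩
  exact (χ.contMDiff y).mul (hg.contMDiffAt (hs.mem_nhds (hχ (tsupport_mul_subset_left hy))))

end SmoothFunctions

section BumpFunctions

variable {EN : Type*} [NormedAddCommGroup EN] [NormedSpace ℝ EN] [FiniteDimensional ℝ EN]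
  {HN : Type*} [TopologicalSpace HN] {J : ModelWithCorners ℝ EN HN}
  {N : Type*} [TopologicalSpace N] [ChartedSpace HN N] [IsManifold J ∞ N] [T2Space N]

theorem exists_contMDiffMap_eventuallyEq_one {x : N} {s : Set N} (hs : s ∈ 𝓝 x) :
    ∃ χ : C^∞⟮J, N; 𝓘(ℝ), ℝ⟯, χ =ᶠ[𝓝 x] 1 ∧ tsupport χ ⊆ s := by
  obtain ⟨χ, -, hχ⟩ := (SmoothBumpFunction.nhds_basis_tsupport (I := J) x).mem_iff.1 hs
  exact ⟨⟨χ, χ.contMDiff⟩, χ.eventuallyEq_one, hχ⟩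

theorem exists_contMDiffMap_eventuallyEq {x : N} {s : Set N} (hs : s ∈ 𝓝 x)
    {g : N → ℝ} (hg : ContMDiffOn J 𝓘(ℝ) ∞ g s) :
    ∃ h : C^∞⟮J, N; 𝓘(ℝ), ℝ⟯, h =ᶠ[𝓝 x] g := by
  obtain ⟨t, hts, ht, hxt⟩ := mem_nhds_iff.1 hs
  obtain ⟨χ, hχx, hχ⟩ := exists_contMDiffMap_eventuallyEq_one (J := J) (ht.mem_nhds hxt)
  obtain ⟨h, hh⟩ := exists_contMDiffMap_eq_mul ht hχ (hg.mono hts)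
  exact ⟨h, hχx.mono fun y hy ↦ by simp [hh, hy]⟩

theorem pointDerivation_eq_of_eventuallyEq {x : N} (D : PointDerivation J x)
    {f g : C^∞⟮J, N; 𝓘(ℝ), ℝ⟯} (h : f =ᶠ[𝓝 x] g) : D f = D g := by
  obtain ⟨χ, hχx, hχ⟩ := exists_contMDiffMap_eventuallyEq_one (J := J) h
  have hχfg : χ * (f - g) = 0 := by
    ext y
    by_cases hy : y ∈ tsupport χ
    · simp [show f y = g y from hχ hy]
    · simp [image_eq_zero_of_notMem_tsupport hy]
  have hfg : (f - g) x = 0 := sub_eq_zero.2 h.self_of_nhds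
  have hD : D (χ * (f - g)) = χ x * D (f - g) + (f - g) x * D χ := D.leibniz χ (f - g)
  rw [hχfg, hχx.self_of_nhds, hfg, Pi.one_apply, one_mul, zero_mul, add_zero] at hD
  exact sub_eq_zero.1 ((map_sub D f g).symm.trans (hD.symm.trans (map_zero D)))

end BumpFunctions

section Charts

variable {EN : Type*} [NormedAddCommGroup EN] [NormedSpace ℝ EN]
  {HN : Type*} [TopologicalSpace HN] {J : ModelWithCorners ℝ EN HN}
  {N : Type*} [TopologicalSpace N] [ChartedSpace HN N]

theorem differential_eq_fderiv [J.Boundaryless] (f : C^∞⟮J, N; 𝓘(ℝ), ℝ⟯) (x : N) :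
    differential J f x = fderiv ℝ (f ∘ (extChartAt J x).symm) (extChartAt J x x) := by
  have h := (mdifferentiableAt_contMDiffMap f x).mvfderiv
  rwa [J.range_eq_univ, fderivWithin_univ] at h

variable [IsManifold J ∞ N]

theorem contMDiffOn_comp_extChartAt_symm (f : C^∞⟮J, N; 𝓘(ℝ), ℝ⟯) (x : N) :
    ContMDiffOn 𝓘(ℝ, EN) 𝓘(ℝ) ∞ (f ∘ (extChartAt J x).symm) (extChartAt J x).target :=
  f.contMDiff.comp_contMDiffOn (contMDiffOn_extChartAt_symm x)

variable [J.Boundaryless]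

theorem differential_eq_fderiv_comp (f : C^∞⟮J, N; 𝓘(ℝ), ℝ⟯) {x y : N}
    (hy : y ∈ (extChartAt J x).source) :
    differential J f y = (fderiv ℝ (f ∘ (extChartAt J x).symm) (extChartAt J x y)).comp
      (mfderiv J 𝓘(ℝ, EN) (extChartAt J x) y) := by
  have hφ := mdifferentiableAt_extChartAt (I := J) (x := x) (y := y) (by simpa using hy)
  have hf : MDifferentiableAt 𝓘(ℝ, EN) 𝓘(ℝ) (f ∘ (extChartAt J x).symm) (extChartAt J x y) :=
    ((contMDiffOn_comp_extChartAt_symm f x).contMDiffAt ((isOpen_extChartAt_target x).mem_nhds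
      ((extChartAt J x).map_source hy))).mdifferentiableAt (by simp)
  have hfφ : (f : N → ℝ) =ᶠ[𝓝 y] (f ∘ (extChartAt J x).symm) ∘ extChartAt J x := by
    filter_upwards [(isOpen_extChartAt_source (I := J) x).mem_nhds hy] with z hz
    rw [Function.comp_apply, Function.comp_apply, (extChartAt J x).left_inv hz]
  have h := hfφ.mfderiv_eq (I := J) (I' := 𝓘(ℝ))
  rw [mfderiv_comp y hf hφ, mfderiv_eq_fderiv] at h
  ext v
  exact DFunLike.congr_fun h v

theorem exists_differential_eq_sum_smul {ι : Type*} [Fintype ι] {x : N}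
    (b : Basis ι ℝ (CotangentSpace J x)) {l : ι → C^∞⟮J, N; 𝓘(ℝ), ℝ⟯}
    (hl : ∀ i, differential J (l i) x = b i) (f : C^∞⟮J, N; 𝓘(ℝ), ℝ⟯) :
    ∃ c : ι → N → ℝ, (∀ i, ContMDiffAt J 𝓘(ℝ) ∞ (c i) x) ∧
      ∀ᶠ y in 𝓝 x, differential J f y = ∑ i, c i y • differential J (l i) y := by
  let φ := extChartAt J x
  let d (h : C^∞⟮J, N; 𝓘(ℝ), ℝ⟯) : EN → EN →L[ℝ] ℝ := fderiv ℝ (h ∘ φ.symm)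
  have hd (h : C^∞⟮J, N; 𝓘(ℝ), ℝ⟯) : ContDiffAt ℝ ∞ (d h) (φ x) :=
    ((contMDiffOn_comp_extChartAt_symm h x).contDiffOn.contDiffAt
      (extChartAt_target_mem_nhds x)).fderiv_right (by simp)
  obtain ⟨c, hc, hf⟩ := exists_contDiffAt_eq_sum_smul (b : Basis ι ℝ (EN →L[ℝ] ℝ))
    (l := fun i ↦ d (l i)) (fun i ↦ (differential_eq_fderiv (l i) x).symm.trans (hl i))
    (fun i ↦ hd (l i)) (hd f)
  refine ⟨fun i y ↦ c (φ y) i, fun i ↦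
    (contDiffAt_pi.1 hc i).contMDiffAt.comp x (contMDiffAt_extChartAt (I := J)), ?_⟩
  filter_upwards [(continuousAt_extChartAt (I := J) x).eventually hf,
    extChartAt_source_mem_nhds (I := J) x] with y hy hyφ
  simp only [differential_eq_fderiv_comp _ hyφ]
  let T : TangentSpace J y →L[ℝ] EN := mfderiv J 𝓘(ℝ, EN) φ y
  have hsum : (∑ i, c (φ y) i • d (l i) (φ y)).comp T =
      ∑ i, c (φ y) i • (d (l i) (φ y)).comp T := by
    simp only [ContinuousLinearMap.finsetSum_comp, ContinuousLinearMap.smul_comp]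
  exact (congrArg (·.comp T) hy).trans hsum

variable [FiniteDimensional ℝ EN] [T2Space N]

theorem exists_differential_eq (x : N) (α : CotangentSpace J x) :
    ∃ f : C^∞⟮J, N; 𝓘(ℝ), ℝ⟯, differential J f x = α := by
  let α' : EN →L[ℝ] ℝ := α
  have hα : ContMDiffOn J 𝓘(ℝ) ∞ (α' ∘ extChartAt J x) (extChartAt J x).source := by
    rw [extChartAt_source]
    exact α'.contMDiff.comp_contMDiffOn contMDiffOn_extChartAt
  obtain ⟨f, hf⟩ := exists_contMDiffMap_eventuallyEq (extChartAt_source_mem_nhds x) hα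
  have hfα : f ∘ (extChartAt J x).symm =ᶠ[𝓝 (extChartAt J x x)] α' := by
    have hf' := (continuousAt_extChartAt_symm (I := J) x).eventually
      (by rwa [extChartAt_to_inv])
    filter_upwards [hf', extChartAt_target_mem_nhds (I := J) x] with y hy hyφ
    rw [Function.comp_apply, hy, Function.comp_apply, (extChartAt J x).right_inv hyφ]
  exact ⟨f, (differential_eq_fderiv f x).trans (hfα.fderiv_eq.trans α'.fderiv)⟩

/- Hadamard's lemma in a chart: the `g i` are the coordinates, the `h i` are the components of
the averaged derivative. -/
theorem exists_eventuallyEq_const_add_sum_mul (f : C^∞⟮J, N; 𝓘(ℝ), ℝ⟯) (x : N) :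
    ∃ g h : Fin (finrank ℝ EN) → C^∞⟮J, N; 𝓘(ℝ), ℝ⟯,
      f =ᶠ[𝓝 x] (ContMDiffMap.const (f x) + ∑ i, g i * h i : C^∞⟮J, N; 𝓘(ℝ), ℝ⟯) ∧
        (∀ i, g i x = 0) ∧ (differential J f x = 0 → ∀ i, h i x = 0) := by
  let φ := extChartAt J x
  let b := finBasis ℝ EN
  have hφ : ContMDiffOn J 𝓘(ℝ, EN) ∞ φ φ.source := by
    rw [extChartAt_source]
    exact contMDiffOn_extChartAt
  obtain ⟨f', hf'⟩ := exists_contMDiffMap_eventuallyEq (extChartAt_target_mem_nhds (I := J) x)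
    (contMDiffOn_comp_extChartAt_symm f x)
  obtain ⟨G, hG, hGx, hf'G⟩ := exists_contDiff_eq_add_apply_sub f'.contMDiff.contDiff (φ x)
  choose g hg using fun i ↦ exists_contMDiffMap_eventuallyEq (extChartAt_source_mem_nhds x)
    (((b.coord i).toContinuousLinearMap.contDiff.comp
      (contDiff_id.sub (contDiff_const (c := φ x)))).contMDiff.comp_contMDiffOn hφ)
  choose h hh using fun i ↦ exists_contMDiffMap_eventuallyEq (extChartAt_source_mem_nhds x)
    ((hG.clm_apply (contDiff_const (c := b i))).contMDiff.comp_contMDiffOn hφ)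
  have hff' : ∀ᶠ y in 𝓝 x, f' (φ y) = f y := by
    filter_upwards [(continuousAt_extChartAt (I := J) x).eventually hf',
      extChartAt_source_mem_nhds (I := J) x] with y hy hyφ
    rw [hy, Function.comp_apply, (extChartAt J x).left_inv hyφ]
  refine ⟨g, h, ?_, fun i ↦ by simp [(hg i).self_of_nhds], fun hf i ↦ ?_⟩
  · filter_upwards [hff', eventually_all.2 hg, eventually_all.2 hh] with y hy hgy hhy
    have hGy : G (φ y) (φ y - φ x) = ∑ i, b.repr (φ y - φ x) i * G (φ y) (b i) := by
      conv_lhs => rw [← b.sum_repr (φ y - φ x)]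
      simp
    rw [ContMDiffMap.coe_add, Pi.add_apply, contMDiffMap_sum_apply, ← hy, hf'G, hff'.self_of_nhds,
      hGy]
    exact congrArg (f x + ·) (Finset.sum_congr rfl fun i _ ↦ by
      rw [ContMDiffMap.coe_mul, Pi.mul_apply, hgy, hhy]; rfl)
  · rw [hf'.fderiv_eq, ← differential_eq_fderiv, hf] at hGx
    exact (hh i).self_of_nhds.trans (DFunLike.congr_fun hGx (b i))

theorem pointDerivation_eq_zero_of_differential_eq_zero {x : N} (D : PointDerivation J x)
    {f : C^∞⟮J, N; 𝓘(ℝ), ℝ⟯} (hf : differential J f x = 0) : D f = 0 := by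
  obtain ⟨g, h, hfgh, hg, hh⟩ := exists_eventuallyEq_const_add_sum_mul f x
  have hconst : D (ContMDiffMap.const (f x) : C^∞⟮J, N; 𝓘(ℝ), ℝ⟯) = 0 := D.map_algebraMap (f x)
  have hmul (i) : D (g i * h i) = g i x * D (h i) + h i x * D (g i) := D.leibniz (g i) (h i)
  calc
    D f = D (ContMDiffMap.const (f x) + ∑ i, g i * h i : C^∞⟮J, N; 𝓘(ℝ), ℝ⟯) :=
      pointDerivation_eq_of_eventuallyEq D hfgh
    _ = D (ContMDiffMap.const (f x) : C^∞⟮J, N; 𝓘(ℝ), ℝ⟯) + ∑ i, D (g i * h i) :=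
      (map_add D _ _).trans (congrArg _ (map_sum D _ _))
    _ = 0 := by simp [hconst, hmul, hg, hh hf]

theorem exists_tangent_of_pointDerivation {x : N} (D : PointDerivation J x) :
    ∃ v : TangentSpace J x, ∀ f : C^∞⟮J, N; 𝓘(ℝ), ℝ⟯, D f = differential J f x v := by
  let b : Basis (Fin (finrank ℝ EN)) ℝ EN := finBasis ℝ EN
  choose l hl using fun i ↦ exists_differential_eq (J := J) x (b.coord i).toContinuousLinearMap
  let v : EN := ∑ i, D (l i) • b i
  refine ⟨v, fun f ↦ ?_⟩
  let df : EN →L[ℝ] ℝ := differential J f x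
  have hdf : df = ∑ i, df (b i) • (b.coord i).toContinuousLinearMap := by
    refine ContinuousLinearMap.coe_injective (b.ext fun j ↦ ?_)
    simp [Finsupp.single_apply]
  have hf : differential J (f - ∑ i, df (b i) • l i) x = 0 := by
    rw [differential_sub, differential_sum, sub_eq_zero]
    simp_rw [differential_smul, hl]
    exact hdf
  calc
    D f = D (∑ i, df (b i) • l i : C^∞⟮J, N; 𝓘(ℝ), ℝ⟯) := sub_eq_zero.1
      ((map_sub D _ _).symm.trans (pointDerivation_eq_zero_of_differential_eq_zero D hf))
    _ = ∑ i, D (l i) • df (b i) := (map_sum D _ _).trans <| Finset.sum_congr rfl fun i _ ↦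
      (D.map_smul _ _).trans (mul_comm _ _)
    _ = df v := by simp only [v, map_sum, map_smul]

theorem derivation_apply_congr (X : Derivation ℝ C^∞⟮J, N; 𝓘(ℝ), ℝ⟯ C^∞⟮J, N; 𝓘(ℝ), ℝ⟯) {x : N}
    {f g : C^∞⟮J, N; 𝓘(ℝ), ℝ⟯} (h : differential J f x = differential J g x) :
    X f x = X g x := by
  have hfg := pointDerivation_eq_zero_of_differential_eq_zero (Derivation.evalAt x X)
    (f := f - g) (by rw [differential_sub, h, sub_self])
  rw [Derivation.evalAt_apply, map_sub] at hfg
  exact sub_eq_zero.1 hfg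

end Charts

section BilinearForms

variable {K L V : Type*} [Field K] [AddCommGroup L] [Module K L] [AddCommGroup V] [Module K V]

theorem exists_bilinForm_apply_eq_of_surjective {q : L →ₗ[K] V} (hq : Function.Surjective q)
    {c : LinearMap.BilinForm K L} (hc : c.IsAlt) (hker : ∀ l l', q l = 0 → c l l' = 0) :
    ∃ B : LinearMap.BilinForm K V, B.IsAlt ∧ ∀ l l', B (q l) (q l') = c l l' := by
  obtain ⟨s, hs⟩ := q.exists_rightInverse_of_surjective (LinearMap.range_eq_top.2 hq)
  have hsq (l) : q (s (q l)) = q l := DFunLike.congr_fun hs (q l)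
  have hcongr (l l') : c (s (q l)) l' = c l l' := by
    rw [← sub_eq_zero, ← LinearMap.sub_apply, ← map_sub]
    exact hker _ _ (by rw [map_sub, hsq, sub_self])
  refine ⟨c.compl₁₂ s s, fun v ↦ hc (s v), fun l l' ↦ ?_⟩
  rw [LinearMap.compl₁₂_apply, hcongr, ← hc.neg_eq, hcongr, hc.neg_eq]

/-- An alternating bilinear form, as an alternating map in two variables. -/
def alternatingMapOfBilinForm {B : LinearMap.BilinForm K V} (hB : B.IsAlt) :
    V [⋀^Fin 2]→ₗ[K] K where
  toFun v := B (v 0) (v 1)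
  map_update_add' v i a b := by fin_cases i <;> simp
  map_update_smul' v i c a := by fin_cases i <;> simp
  map_eq_zero_of_eq' v i j h hij := by
    have hB' : ∀ v, B v v = 0 := hB
    fin_cases i <;> fin_cases j <;> simp_all

end BilinearForms

section Biderivations

variable {EN : Type*} [NormedAddCommGroup EN] [NormedSpace ℝ EN]
  {HN : Type*} [TopologicalSpace HN] {J : ModelWithCorners ℝ EN HN}
  {N : Type*} [TopologicalSpace N] [ChartedSpace HN N]

/-- Evaluation of smooth functions at a point, as a linear map. -/
def evalₗ (x : N) : C^∞⟮J, N; 𝓘(ℝ), ℝ⟯ →ₗ[ℝ] ℝ where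
  toFun f := f x
  map_add' _ _ := rfl
  map_smul' _ _ := rfl

/-- The bracket `(f, g) ↦ B (df, dg)` on `C^∞(N)` defined by a field `B` of bilinear forms on the
cotangent spaces which is smooth in the sense that it maps smooth functions to smooth functions. -/
def biderivation (B : ∀ x : N, LinearMap.BilinForm ℝ (CotangentSpace J x))
    (hB : ∀ f g : C^∞⟮J, N; 𝓘(ℝ), ℝ⟯,
      ContMDiff J 𝓘(ℝ) ∞ fun x ↦ B x (differential J f x) (differential J g x)) :
    C^∞⟮J, N; 𝓘(ℝ), ℝ⟯ →ₗ[ℝ] C^∞⟮J, N; 𝓘(ℝ), ℝ⟯ →ₗ[ℝ] C^∞⟮J, N; 𝓘(ℝ), ℝ⟯ :=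
  LinearMap.mk₂ ℝ (fun f g ↦ ⟨_, hB f g⟩)
    (fun f f' g ↦ ContMDiffMap.ext fun x ↦ (congrArg (B x · (differential J g x))
      (differential_add f f' x)).trans (LinearMap.map_add₂ (B x) _ _ _))
    (fun c f g ↦ ContMDiffMap.ext fun x ↦ (congrArg (B x · (differential J g x))
      (differential_smul c f x)).trans (LinearMap.map_smul₂ (B x) c _ _))
    (fun _ g g' ↦ ContMDiffMap.ext fun x ↦ (congrArg (B x _) (differential_add g g' x)).trans
      (map_add (B x _) _ _))
    (fun c _ g ↦ ContMDiffMap.ext fun x ↦ (congrArg (B x _) (differential_smul c g x)).trans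
      (map_smul (B x _) c _))

variable {B : ∀ x : N, LinearMap.BilinForm ℝ (CotangentSpace J x)}
  (hB : ∀ f g : C^∞⟮J, N; 𝓘(ℝ), ℝ⟯,
    ContMDiff J 𝓘(ℝ) ∞ fun x ↦ B x (differential J f x) (differential J g x))

theorem biderivation_apply (f g : C^∞⟮J, N; 𝓘(ℝ), ℝ⟯) (x : N) :
    biderivation B hB f g x = B x (differential J f x) (differential J g x) :=
  rfl

theorem biderivation_mul (f g h : C^∞⟮J, N; 𝓘(ℝ), ℝ⟯) :
    biderivation B hB f (g * h) = biderivation B hB f g * h + g * biderivation B hB f h := by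
  ext x
  simp only [ContMDiffMap.coe_add, ContMDiffMap.coe_mul, Pi.add_apply, Pi.mul_apply,
    biderivation_apply, differential_mul, map_add, map_smul, smul_eq_mul]
  ring

theorem biderivation_skew (hBalt : ∀ x, (B x).IsAlt) (f g : C^∞⟮J, N; 𝓘(ℝ), ℝ⟯) :
    biderivation B hB f g = -biderivation B hB g f := by
  ext x
  exact ((hBalt x).neg_eq _ _).symm

/-- The differentials of the functions `D l` exhaust all cotangent spaces. A biderivation is then
determined by its values on these functions. -/
def DifferentialsExhaust {L : Type*} (D : L → C^∞⟮J, N; 𝓘(ℝ), ℝ⟯) : Prop :=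
  ∀ x : N, Function.Surjective fun l ↦ differential J (D l) x

theorem differentialsExhaust_of_separating [FiniteDimensional ℝ EN] {L : Type*} [AddCommGroup L]
    [Module ℝ L] (D : L →ₗ[ℝ] C^∞⟮J, N; 𝓘(ℝ), ℝ⟯)
    (h : ∀ (x : N) (v : TangentSpace J x), (∀ l, differential J (D l) x v = 0) → v = 0) :
    DifferentialsExhaust D := by
  intro x α
  let B : EN →ₗ[ℝ] L →ₗ[ℝ] ℝ := LinearMap.mk₂ ℝ (fun v l ↦ differential J (D l) x v)
    (fun v w l ↦ map_add (differential J (D l) x) v w)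
    (fun c v l ↦ map_smul (differential J (D l) x) c v)
    (fun v l l' ↦ by rw [map_add, differential_add]; rfl)
    (fun c v l ↦ by rw [map_smul, differential_smul]; rfl)
  have hB : Function.Injective B := by
    rw [← LinearMap.ker_eq_bot, LinearMap.ker_eq_bot']
    exact fun v hv ↦ h x v fun l ↦ LinearMap.congr_fun hv l
  obtain ⟨l, hl⟩ := LinearMap.flip_surjective_iff₁.2 hB
    (ContinuousLinearMap.toLinearMap (M := EN) (M₂ := ℝ) α)
  exact ⟨l, ContinuousLinearMap.coe_injective hl⟩

variable [FiniteDimensional ℝ EN] [J.Boundaryless] [IsManifold J ∞ N]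

theorem DifferentialsExhaust.contMDiff_bilinForm {L : Type*} {D : L → C^∞⟮J, N; 𝓘(ℝ), ℝ⟯}
    (hD : DifferentialsExhaust D)
    (hB : ∀ l l', ContMDiff J 𝓘(ℝ) ∞
      fun x ↦ B x (differential J (D l) x) (differential J (D l') x))
    (f g : C^∞⟮J, N; 𝓘(ℝ), ℝ⟯) :
    ContMDiff J 𝓘(ℝ) ∞ fun x ↦ B x (differential J f x) (differential J g x) := by
  intro x
  have : FiniteDimensional ℝ (CotangentSpace J x) :=
    inferInstanceAs (FiniteDimensional ℝ (EN →L[ℝ] ℝ))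
  let b := finBasis ℝ (CotangentSpace J x)
  choose l hl using fun i ↦ hD x (b i)
  obtain ⟨c, hc, hcf⟩ := exists_differential_eq_sum_smul b hl f
  obtain ⟨c', hc', hcg⟩ := exists_differential_eq_sum_smul b hl g
  have hsum : ContMDiffAt J 𝓘(ℝ) ∞ (fun y ↦ ∑ i, c i y * ∑ j, c' j y *
      B y (differential J (D (l i)) y) (differential J (D (l j)) y)) x :=
    contMDiffAt_finsetSum fun i _ ↦ (hc i).mul <| contMDiffAt_finsetSum fun j _ ↦
      (hc' j).mul (hB _ _ x)
  refine hsum.congr_of_eventuallyEq ?_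
  filter_upwards [hcf, hcg] with y hf hg
  rw [hf, hg]
  simp only [map_sum, map_smul, LinearMap.sum_apply, LinearMap.smul_apply, smul_eq_mul,
    Finset.mul_sum]
  rw [Finset.sum_comm]
  exact Finset.sum_congr rfl fun i _ ↦ Finset.sum_congr rfl fun j _ ↦ by ring

variable [T2Space N]

/- The Jacobiator `[X_f, X_g] h - X_{X_f g} h` is invariant under cyclic permutations and
a derivation in `h`, so it may be tested on the spanning family in one slot after the other. -/
theorem DifferentialsExhaust.jacobi {L : Type*} {D : L → C^∞⟮J, N; 𝓘(ℝ), ℝ⟯}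
    (hD : DifferentialsExhaust D)
    {b : C^∞⟮J, N; 𝓘(ℝ), ℝ⟯ →ₗ[ℝ] C^∞⟮J, N; 𝓘(ℝ), ℝ⟯ →ₗ[ℝ] C^∞⟮J, N; 𝓘(ℝ), ℝ⟯}
    (hskew : ∀ f g, b f g = -b g f) (hleib : ∀ f g h, b f (g * h) = b f g * h + g * b f h)
    (hjac : ∀ l l' l'', b (D l) (b (D l') (D l'')) =
      b (b (D l) (D l')) (D l'') + b (D l') (b (D l) (D l''))) (f g h : C^∞⟮J, N; 𝓘(ℝ), ℝ⟯) :
    b f (b g h) = b (b f g) h + b g (b f h) := by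
  let X (f : C^∞⟮J, N; 𝓘(ℝ), ℝ⟯) : Derivation ℝ C^∞⟮J, N; 𝓘(ℝ), ℝ⟯ C^∞⟮J, N; 𝓘(ℝ), ℝ⟯ :=
    .mk' (b f) fun g h ↦ by rw [hleib, add_comm, smul_eq_mul, smul_eq_mul, mul_comm h]
  let jac (f g : C^∞⟮J, N; 𝓘(ℝ), ℝ⟯) := ⁅X f, X g⁆ - X (b f g)
  have hjac_apply (f g h) : jac f g h = b f (b g h) - b g (b f h) - b (b f g) h := by
    rw [Derivation.sub_apply, Derivation.commutator_apply]
    rfl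
  have hcyclic (f g h) : jac f g h = jac g h f := by
    rw [hjac_apply, hjac_apply, hskew f (b g h), hskew f h, hskew h f, hskew f g,
      hskew h (b g f), map_neg, map_neg, map_neg, LinearMap.neg_apply]
    abel
  have htest {f g} (h0 : ∀ l, jac f g (D l) = 0) (h) : jac f g h = 0 := by
    ext x
    obtain ⟨l, hl⟩ := hD x (differential J h x)
    rw [derivation_apply_congr _ hl.symm, h0]
  have hDD (l l' h) : jac (D l) (D l') h = 0 :=
    htest (fun l'' ↦ by rw [hjac_apply, hjac]; abel) h
  have hDf (l f h) : jac (D l) f h = 0 :=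
    htest (fun l' ↦ by rw [hcyclic, hcyclic, hDD]) h
  have hfg : jac f g h = 0 := htest (fun l ↦ by rw [hcyclic, hcyclic, hDf]) h
  rw [hjac_apply, sub_sub, sub_eq_zero] at hfg
  rw [hfg, add_comm]

theorem exists_poissonStructure {L : Type*} [AddCommGroup L] [Module ℝ L]
    {D : L →ₗ[ℝ] C^∞⟮J, N; 𝓘(ℝ), ℝ⟯} (hD : DifferentialsExhaust D) {β : L →ₗ[ℝ] L →ₗ[ℝ] L}
    (hβ : ∀ l, β l l = 0)
    (hker : ∀ (x : N) (l : L), differential J (D l) x = 0 → ∀ l', D (β l l') x = 0)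
    (hjac : ∀ l l' l'', D (β l (β l' l'')) = D (β (β l l') l'') + D (β l' (β l l''))) :
    ∃ P : PoissonStructure J N, ∀ l l', P.bracket (D l) (D l') = D (β l l') := by
  have hB (x : N) : ∃ B : LinearMap.BilinForm ℝ (CotangentSpace J x), B.IsAlt ∧
      ∀ l l', B (differential J (D l) x) (differential J (D l') x) = D (β l l') x :=
    exists_bilinForm_apply_eq_of_surjective (q := differentialₗ J x ∘ₗ D) (hD x)
      (c := β.compr₂ (evalₗ x ∘ₗ D))
      (fun l ↦ by simp [hβ]) fun l l' hl ↦ hker x l hl l'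
  choose B hBalt hBD using hB
  have hsmooth := hD.contMDiff_bilinForm (B := B) fun l l' ↦
    (D (β l l')).contMDiff.congr fun x ↦ hBD x l l'
  have hbD (l l') : biderivation B hsmooth (D l) (D l') = D (β l l') :=
    ContMDiffMap.ext fun x ↦ hBD x l l'
  exact ⟨⟨biderivation B hsmooth, biderivation_skew hsmooth hBalt, biderivation_mul hsmooth,
    hD.jacobi (biderivation_skew hsmooth hBalt) (biderivation_mul hsmooth) fun l l' l'' ↦ by
      simpa only [hbD] using hjac l l' l''⟩, hbD⟩

end Biderivations

namespace PoissonStructure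

variable {EN : Type*} [NormedAddCommGroup EN] [NormedSpace ℝ EN]
  {HN : Type*} [TopologicalSpace HN] {J : ModelWithCorners ℝ EN HN}
  {N : Type*} [TopologicalSpace N] [ChartedSpace HN N]

theorem bracket_self (P : PoissonStructure J N) (f : C^∞⟮J, N; 𝓘(ℝ), ℝ⟯) : P.bracket f f = 0 := by
  ext x
  exact self_eq_neg.1 (DFunLike.congr_fun (P.skew f f) x)

theorem bracket_mul_left (P : PoissonStructure J N) (f g h : C^∞⟮J, N; 𝓘(ℝ), ℝ⟯) :
    P.bracket (f * g) h = P.bracket f h * g + f * P.bracket g h := by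
  rw [P.skew, P.leibniz, P.skew h, P.skew h]
  ring

/-- The Hamiltonian vector field `{f, ·}` of `f`, as a derivation. -/
def hamiltonian (P : PoissonStructure J N) (f : C^∞⟮J, N; 𝓘(ℝ), ℝ⟯) :
    Derivation ℝ C^∞⟮J, N; 𝓘(ℝ), ℝ⟯ C^∞⟮J, N; 𝓘(ℝ), ℝ⟯ :=
  .mk' (P.bracket f) fun g h ↦ by
    rw [P.leibniz, add_comm, smul_eq_mul, smul_eq_mul, mul_comm h]

variable [FiniteDimensional ℝ EN] [J.Boundaryless] [IsManifold J ∞ N] [T2Space N]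

theorem bracket_apply_congr (P : PoissonStructure J N) {x : N} {f f' g g' : C^∞⟮J, N; 𝓘(ℝ), ℝ⟯}
    (hf : differential J f x = differential J f' x)
    (hg : differential J g x = differential J g' x) :
    P.bracket f g x = P.bracket f' g' x := by
  calc
    P.bracket f g x = P.bracket f g' x := derivation_apply_congr (P.hamiltonian f) hg
    _ = -P.bracket g' f x := DFunLike.congr_fun (P.skew f g') x
    _ = -P.bracket g' f' x := congrArg (-·) (derivation_apply_congr (P.hamiltonian g') hf)
    _ = P.bracket f' g' x := (DFunLike.congr_fun (P.skew f' g') x).symm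

theorem exists_hasBivector (P : PoissonStructure J N) :
    ∃ u : MultivectorField J N 2, HasBivector J P u := by
  have hB (x : N) : ∃ B : LinearMap.BilinForm ℝ (CotangentSpace J x), B.IsAlt ∧
      ∀ f g, B (differential J f x) (differential J g x) = P.bracket f g x :=
    exists_bilinForm_apply_eq_of_surjective (q := differentialₗ J x) (exists_differential_eq x)
      (c := P.bracket.compr₂ (evalₗ x))
      (fun f ↦ by simp [P.bracket_self]) fun f g hf ↦
        (P.bracket_apply_congr (f' := 0) (hf.trans (differentialₗ J x).map_zero.symm) rfl).trans
          (by simp)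
  choose B hBalt hB using hB
  exact ⟨fun x ↦ alternatingMapOfBilinForm (hBalt x), fun f g x ↦ hB x f g⟩

theorem eq_of_bracket_eq {L : Type*} {D : L → C^∞⟮J, N; 𝓘(ℝ), ℝ⟯} (hD : DifferentialsExhaust D)
    {P Q : PoissonStructure J N} (h : ∀ l l', P.bracket (D l) (D l') = Q.bracket (D l) (D l')) :
    P = Q := by
  ext f g x
  obtain ⟨l, hl⟩ := hD x (differential J f x)
  obtain ⟨l', hl'⟩ := hD x (differential J g x)
  rw [P.bracket_apply_congr hl.symm hl'.symm, Q.bracket_apply_congr hl.symm hl'.symm, h]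

theorem bracket_eq_zero_of_finrank_le_one (h : finrank ℝ EN ≤ 1) (P : PoissonStructure J N)
    (f g : C^∞⟮J, N; 𝓘(ℝ), ℝ⟯) : P.bracket f g = 0 := by
  ext x
  have : FiniteDimensional ℝ (CotangentSpace J x) :=
    inferInstanceAs (FiniteDimensional ℝ (EN →L[ℝ] ℝ))
  have hdim : finrank ℝ (CotangentSpace J x) ≤ 1 :=
    ((LinearMap.toContinuousLinearMap (𝕜 := ℝ) (E := EN) (F' := ℝ)).finrank_eq.symm.trans
      Subspace.dual_finrank_eq).trans_le h
  obtain ⟨α, hα⟩ := finrank_le_one_iff.1 hdim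
  obtain ⟨a, ha⟩ := hα (differential J f x)
  obtain ⟨b, hb⟩ := hα (differential J g x)
  obtain ⟨k, rfl⟩ := exists_differential_eq x α
  rw [P.bracket_apply_congr (f' := a • k) (g' := b • k) (by rw [differential_smul, ha])
    (by rw [differential_smul, hb])]
  simp [P.bracket_self]

end PoissonStructure

theorem t2Space_totalSpace {B F : Type*} [TopologicalSpace B] [T2Space B] [TopologicalSpace F]
    [T2Space F] {E : B → Type*} [TopologicalSpace (TotalSpace F E)] [∀ x, TopologicalSpace (E x)]
    [FiberBundle F E] : T2Space (TotalSpace F E) := by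
  refine ⟨fun v w hvw ↦ ?_⟩
  by_cases h : v.proj = w.proj
  · let e := trivializationAt F E v.proj
    have hv : v ∈ e.source := e.mem_source.2 (mem_baseSet_trivializationAt F E v.proj)
    have hw : w ∈ e.source := e.mem_source.2 (h ▸ mem_baseSet_trivializationAt F E v.proj)
    have he : (e v).2 ≠ (e w).2 := fun h2 ↦ hvw (e.injOn hv hw
      (Prod.ext ((e.coe_fst hv).trans (h.trans (e.coe_fst hw).symm)) h2))
    obtain ⟨U, V, hU, hV, hvU, hwV, hUV⟩ := t2_separation he
    have hc : ContinuousOn (fun z ↦ (e z).2) e.source :=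
      continuous_snd.comp_continuousOn e.continuousOn
    exact ⟨e.source ∩ (fun z ↦ (e z).2) ⁻¹' U, e.source ∩ (fun z ↦ (e z).2) ⁻¹' V,
      hc.isOpen_inter_preimage e.open_source hU, hc.isOpen_inter_preimage e.open_source hV,
      ⟨hv, hvU⟩, ⟨hw, hwV⟩, (hUV.preimage _).mono inter_subset_right inter_subset_right⟩
  · obtain ⟨U, V, hU, hV, hvU, hwV, hUV⟩ := t2_separation h
    have hc := FiberBundle.continuous_proj F E
    exact ⟨_, _, hU.preimage hc, hV.preimage hc, hvU, hwV, hUV.preimage _⟩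

section VectorBundles

variable {EM : Type*} [NormedAddCommGroup EM] [NormedSpace ℝ EM]
  {HM : Type*} [TopologicalSpace HM] {I : ModelWithCorners ℝ EM HM}
  {M : Type*} [TopologicalSpace M] [ChartedSpace HM M]
  {F : Type*} [NormedAddCommGroup F] [NormedSpace ℝ F]
  {E : M → Type*} [TopologicalSpace (TotalSpace F E)]
  [∀ x, AddCommGroup (E x)] [∀ x, Module ℝ (E x)] [∀ x, TopologicalSpace (E x)]
  [FiberBundle F E] [VectorBundle ℝ F E]

@[simp]
theorem funSMul_apply (f : C^∞⟮I, M; 𝓘(ℝ), ℝ⟯) (σ : Cₛ^∞⟮I; F, E⟯) (x : M) :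
    ContMDiffSection.funSMul f σ x = f x • σ x := rfl

theorem contMDiffSection_sum_apply {ι : Type*} (s : Finset ι) (σ : ι → Cₛ^∞⟮I; F, E⟯) (x : M) :
    (∑ i ∈ s, σ i) x = ∑ i ∈ s, σ i x := by
  rw [← Finset.sum_apply]
  exact congrFun (map_sum (ContMDiffSection.coeAddHom I F ∞ E) σ s) x

theorem exists_section_eq_smul {χ : C^∞⟮I, M; 𝓘(ℝ), ℝ⟯} {s : Set M} (hs : IsOpen s)
    (hχ : tsupport χ ⊆ s) {τ : ∀ x, E x}
    (hτ : ContMDiffOn I (I.prod 𝓘(ℝ, F)) ∞ (fun x ↦ TotalSpace.mk' F x (τ x)) s) :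
    ∃ σ : Cₛ^∞⟮I; F, E⟯, ∀ x, σ x = χ x • τ x :=
  ⟨⟨_, ContMDiffOn.smul_section_of_tsupport χ.contMDiff.contMDiffOn hs hχ hτ⟩, fun _ ↦ rfl⟩

theorem contMDiff_fiberScaling (t : ℝ) :
    ContMDiff (I.prod 𝓘(ℝ, F)) (I.prod 𝓘(ℝ, F)) ∞ (fiberScaling F t : TotalSpace F E → _) := by
  intro v
  have h := contMDiffAt_totalSpace.1 (contMDiff_id (I := I.prod 𝓘(ℝ, F)) (n := ∞) v)
  have hsmul : ContMDiffAt (I.prod 𝓘(ℝ, F)) 𝓘(ℝ, F) ∞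
      (fun w : TotalSpace F E ↦ t • (trivializationAt F E v.proj w).2) v :=
    (contMDiffAt_const (I' := 𝓘(ℝ)) (c := t)).smul h.2
  refine contMDiffAt_totalSpace.2 ⟨h.1, hsmul.congr_of_eventuallyEq ?_⟩
  let e := trivializationAt F E v.proj
  filter_upwards [e.open_source.mem_nhds
    (e.mem_source.2 (mem_baseSet_trivializationAt F E v.proj))] with w hw
  exact (e.linear ℝ (e.mem_source.1 hw)).map_smul t w.2

variable [ContMDiffVectorBundle ∞ F E I]

theorem contMDiff_mk_trivializationAt_symm (x : M) :
    ContMDiff 𝓘(ℝ, F) (I.prod 𝓘(ℝ, F)) ∞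
      (fun w : F ↦ TotalSpace.mk' F x ((trivializationAt F E x).symm x w)) := by
  have hx := mem_baseSet_trivializationAt F E x
  intro w
  rw [(trivializationAt F E x).contMDiffAt_iff ((trivializationAt F E x).mem_source.2 hx)]
  refine ⟨contMDiffAt_const, contMDiffAt_id.congr_of_eventuallyEq (Eventually.of_forall ?_)⟩
  intro w'
  simp only [(trivializationAt F E x).apply_mk_symm hx, id]

theorem contMDiff_mk_add_smul {x : M} (v w : E x) :
    ContMDiff 𝓘(ℝ) (I.prod 𝓘(ℝ, F)) ∞ (fun t : ℝ ↦ TotalSpace.mk' F x (v + t • w)) := by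
  let e := (trivializationAt F E x).continuousLinearEquivAt ℝ x (mem_baseSet_trivializationAt F E x)
  have hline : ContMDiff 𝓘(ℝ) 𝓘(ℝ, F) ∞ fun t : ℝ ↦ e v + t • e w :=
    contMDiff_const.add (contMDiff_id.smul contMDiff_const)
  convert (contMDiff_mk_trivializationAt_symm (I := I) (E := E) x).comp hline using 2 with t
  have hsymm : e.symm (e v + t • e w) = v + t • w := by
    rw [← map_smul, ← map_add, e.symm_apply_apply]
  exact congrArg (TotalSpace.mk' F x) hsymm.symm

section Extension

variable [FiniteDimensional ℝ EM] [T2Space M] [IsManifold I ∞ M]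

theorem exists_section_eventuallyEq_symm (x : M) (w : F) :
    ∃ σ : Cₛ^∞⟮I; F, E⟯, ∀ᶠ y in 𝓝 x, σ y = (trivializationAt F E x).symm y w := by
  let e := trivializationAt F E x
  have hsymm : ContMDiffOn I (I.prod 𝓘(ℝ, F)) ∞ (fun y ↦ TotalSpace.mk' F y (e.symm y w))
      e.baseSet := by
    rw [e.contMDiffOn_section_baseSet_iff]
    exact contMDiffOn_const.congr fun y hy ↦ by rw [e.apply_mk_symm hy]
  obtain ⟨χ, hχ1, hχ⟩ := exists_contMDiffMap_eventuallyEq_one (J := I)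
    (e.open_baseSet.mem_nhds (mem_baseSet_trivializationAt F E x))
  obtain ⟨σ, hσ⟩ := exists_section_eq_smul e.open_baseSet hχ hsymm
  exact ⟨σ, hχ1.mono fun y hy ↦ by rw [hσ, hy, Pi.one_apply, one_smul]⟩

variable (I F) in
theorem exists_section_apply_eq (x : M) (v : E x) : ∃ σ : Cₛ^∞⟮I; F, E⟯, σ x = v := by
  obtain ⟨σ, hσ⟩ := exists_section_eventuallyEq_symm (I := I) (E := E) x
    (trivializationAt F E x ⟨x, v⟩).2
  exact ⟨σ, hσ.self_of_nhds.trans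
    ((trivializationAt F E x).symm_apply_apply_mk (mem_baseSet_trivializationAt F E x) v)⟩

variable [FiniteDimensional ℝ F]

theorem exists_funSMul_eq_sum_funSMul {σ : Cₛ^∞⟮I; F, E⟯} {x : M} (hσ : σ x = 0) :
    ∃ (ρ : C^∞⟮I, M; 𝓘(ℝ), ℝ⟯) (f : Fin (finrank ℝ F) → C^∞⟮I, M; 𝓘(ℝ), ℝ⟯)
      (s : Fin (finrank ℝ F) → Cₛ^∞⟮I; F, E⟯), ρ x = 1 ∧ (∀ i, f i x = 0) ∧
        ContMDiffSection.funSMul ρ σ = ∑ i, ContMDiffSection.funSMul (f i) (s i) := by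
  let e := trivializationAt F E x
  let b := finBasis ℝ F
  obtain ⟨χ, hχ1, hχ⟩ := exists_contMDiffMap_eventuallyEq_one (J := I)
    (e.open_baseSet.mem_nhds (mem_baseSet_trivializationAt F E x))
  choose s hs using fun i ↦ exists_section_eq_smul e.open_baseSet hχ
    (e.contMDiffOn_localFrame_baseSet (I := I) ∞ b i)
  choose f hf using fun i ↦ exists_contMDiffMap_eq_mul e.open_baseSet hχ
    (contMDiffOn_baseSet_localFrameCoeff b (e := e) σ.contMDiff.contMDiffOn i)
  -- The second factor `χ` is what turns the local frame into global sections.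
  refine ⟨χ * χ, f, s, ?_, fun i ↦ by simp [hf, hσ], ?_⟩
  · simp [hχ1.self_of_nhds]
  · ext y
    simp only [contMDiffSection_sum_apply, funSMul_apply, ContMDiffMap.coe_mul, Pi.mul_apply,
      hf, hs]
    by_cases hy : y ∈ e.baseSet
    · conv_lhs => rw [e.eq_sum_localFrameCoeff_smul (I := I) (b := b) (s := σ) hy]
      rw [Finset.smul_sum]
      refine Finset.sum_congr rfl fun i _ ↦ ?_
      rw [smul_smul, smul_smul, LinearMap.piApply_apply]
      congr 1
      ring
    · simp [image_eq_zero_of_notMem_tsupport fun h ↦ hy (hχ h)]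

theorem map_eq_zero_of_map_funSMul {W : Type*} [AddCommGroup W] [Module ℝ W] {x : M}
    {T : Cₛ^∞⟮I; F, E⟯ →ₗ[ℝ] W} (hT : ∀ f σ, T (ContMDiffSection.funSMul f σ) = f x • T σ)
    {σ : Cₛ^∞⟮I; F, E⟯} (hσ : σ x = 0) : T σ = 0 := by
  obtain ⟨ρ, f, s, hρ, hf, h⟩ := exists_funSMul_eq_sum_funSMul hσ
  rw [← one_smul ℝ (T σ), ← hρ, ← hT, h, map_sum]
  exact Finset.sum_eq_zero fun i _ ↦ by rw [hT, hf, zero_smul]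

theorem exists_clm_apply_eq_of_map_funSMul {W : Type*} [AddCommGroup W] [Module ℝ W]
    [TopologicalSpace W] [IsTopologicalAddGroup W] [ContinuousSMul ℝ W] {x : M}
    {T : Cₛ^∞⟮I; F, E⟯ →ₗ[ℝ] W} (hT : ∀ f σ, T (ContMDiffSection.funSMul f σ) = f x • T σ) :
    ∃ A : E x →L[ℝ] W, ∀ σ : Cₛ^∞⟮I; F, E⟯, A (σ x) = T σ := by
  let q : Cₛ^∞⟮I; F, E⟯ →ₗ[ℝ] E x :=
    { toFun := fun σ ↦ σ x, map_add' := fun _ _ ↦ rfl, map_smul' := fun _ _ ↦ rfl }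
  obtain ⟨r, hr⟩ := q.exists_rightInverse_of_surjective
    (LinearMap.range_eq_top.2 (exists_section_apply_eq I F x))
  let e := (trivializationAt F E x).continuousLinearEquivAt ℝ x (mem_baseSet_trivializationAt F E x)
  let A : F →L[ℝ] W := LinearMap.toContinuousLinearMap (T ∘ₗ r ∘ₗ e.symm.toLinearMap)
  refine ⟨A.comp (e : E x →L[ℝ] F), fun σ ↦ ?_⟩
  have hA : A (e (σ x)) = T (r (σ x)) := congrArg (T ∘ r) (e.symm_apply_apply (σ x))
  rw [ContinuousLinearMap.comp_apply, ContinuousLinearEquiv.coe_coe, hA, ← sub_eq_zero, ← map_sub]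
  exact map_eq_zero_of_map_funSMul hT (sub_eq_zero.2 (LinearMap.congr_fun hr (σ x)))

end Extension

end VectorBundles

section TangentVectors

variable {EM : Type*} [NormedAddCommGroup EM] [NormedSpace ℝ EM]
  {HM : Type*} [TopologicalSpace HM] {I : ModelWithCorners ℝ EM HM}
  {M : Type*} [TopologicalSpace M] [ChartedSpace HM M] [IsManifold I ∞ M]

theorem trivializationAt_tangentSpace_apply {x y : M} (hy : y ∈ (chartAt HM x).source)
    (v : TangentSpace I y) :
    (trivializationAt EM (TangentSpace I) x ⟨y, v⟩).2 =
      mfderiv I 𝓘(ℝ, EM) (extChartAt I x) y v := by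
  have hy' : y ∈ (trivializationAt EM (TangentSpace I) x).baseSet := by simpa using hy
  have h := DFunLike.congr_fun (TangentBundle.continuousLinearMapAt_trivializationAt hy) v
  refine Eq.trans ?_ h
  rw [Trivialization.continuousLinearMapAt_apply, Trivialization.coe_linearMapAt_of_mem _ hy']

theorem contMDiff_differential_apply [I.Boundaryless] (f : C^∞⟮I, M; 𝓘(ℝ), ℝ⟯)
    {X : ∀ x : M, TangentSpace I x}
    (hX : ContMDiff I (I.prod 𝓘(ℝ, EM)) ∞ fun x ↦ TotalSpace.mk' EM x (X x)) :
    ContMDiff I 𝓘(ℝ) ∞ fun x ↦ differential I f x (X x) := by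
  intro x
  have hf : ContDiffAt ℝ ∞ (fderiv ℝ (f ∘ (extChartAt I x).symm)) (extChartAt I x x) :=
    ((contMDiffOn_comp_extChartAt_symm f x).contDiffOn.contDiffAt
      (extChartAt_target_mem_nhds (I := I) x)).fderiv_right (by simp)
  refine ((hf.contMDiffAt.comp x (contMDiffAt_extChartAt (I := I))).clm_apply
    ((contMDiffAt_section x).1 (hX x))).congr_of_eventuallyEq ?_
  filter_upwards [extChartAt_source_mem_nhds (I := I) x] with y hy
  rw [trivializationAt_tangentSpace_apply (by simpa using hy), differential_eq_fderiv_comp f hy]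
  rfl

variable [FiniteDimensional ℝ EM] [T2Space M]

theorem contMDiff_of_contMDiff_differential_apply {X : ∀ x : M, TangentSpace I x}
    (hX : ∀ f : C^∞⟮I, M; 𝓘(ℝ), ℝ⟯, ContMDiff I 𝓘(ℝ) ∞ fun x ↦ differential I f x (X x)) :
    ContMDiff I (I.prod 𝓘(ℝ, EM)) ∞ fun x ↦ TotalSpace.mk' EM x (X x) := by
  intro x
  rw [contMDiffAt_section]
  let b := finBasis ℝ EM
  have hφ : ContMDiffOn I 𝓘(ℝ, EM) ∞ (extChartAt I x) (extChartAt I x).source := by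
    rw [extChartAt_source]
    exact contMDiffOn_extChartAt
  choose f hf using fun i ↦ exists_contMDiffMap_eventuallyEq
    (extChartAt_source_mem_nhds (I := I) x)
    ((b.coord i).toContinuousLinearMap.contMDiff.comp_contMDiffOn hφ)
  have hsum : ContMDiffAt I 𝓘(ℝ, EM) ∞ (fun y ↦ ∑ i, differential I (f i) y (X y) • b i) x :=
    contMDiffAt_finsetSum fun i _ ↦
      (((ContinuousLinearMap.id ℝ ℝ).smulRight (b i)).contMDiff.contMDiffAt.comp x (hX (f i) x))
  refine hsum.congr_of_eventuallyEq ?_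
  filter_upwards [extChartAt_source_mem_nhds (I := I) x,
    eventually_all.2 fun i ↦ (hf i).eventuallyEq_nhds] with y hy hfy
  have hy' : y ∈ (chartAt HM x).source := by simpa using hy
  rw [trivializationAt_tangentSpace_apply hy']
  conv_lhs => rw [← b.sum_repr (mfderiv I 𝓘(ℝ, EM) (extChartAt I x) y (X y))]
  refine Finset.sum_congr rfl fun i _ ↦ congrArg (· • b i) ?_
  have hd := (hfy i).mfderiv_eq (I := I) (I' := 𝓘(ℝ))
  rw [mfderiv_comp y (b.coord i).toContinuousLinearMap.mdifferentiableAt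
    (mdifferentiableAt_extChartAt hy'), ContinuousLinearMap.mfderiv_eq] at hd
  exact (DFunLike.congr_fun hd (X y)).symm

variable [I.Boundaryless]

theorem eq_of_differential_apply_eq {x : M} {v w : TangentSpace I x}
    (h : ∀ f : C^∞⟮I, M; 𝓘(ℝ), ℝ⟯, differential I f x v = differential I f x w) : v = w := by
  refine (SeparatingDual.eq_iff_forall_dual_eq (R := ℝ) (V := EM)).2 fun α ↦ ?_
  obtain ⟨f, rfl⟩ := exists_differential_eq (J := I) x α
  exact h f

end TangentVectors

section BundleMaps

variable {EM : Type*} [NormedAddCommGroup EM] [NormedSpace ℝ EM]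
  {HM : Type*} [TopologicalSpace HM] {I : ModelWithCorners ℝ EM HM}
  {M : Type*} [TopologicalSpace M] [ChartedSpace HM M]
  {F : Type*} [NormedAddCommGroup F] [NormedSpace ℝ F] [FiniteDimensional ℝ F]
  {E : M → Type*} [TopologicalSpace (TotalSpace F E)]
  [∀ x, AddCommGroup (E x)] [∀ x, Module ℝ (E x)] [∀ x, TopologicalSpace (E x)]
  [FiberBundle F E] [VectorBundle ℝ F E]
  {F' : Type*} [NormedAddCommGroup F'] [NormedSpace ℝ F']
  {E' : M → Type*} [TopologicalSpace (TotalSpace F' E')]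
  [∀ x, AddCommGroup (E' x)] [∀ x, Module ℝ (E' x)] [∀ x, TopologicalSpace (E' x)]
  [∀ x, IsTopologicalAddGroup (E' x)] [∀ x, ContinuousSMul ℝ (E' x)]
  [FiberBundle F' E'] [VectorBundle ℝ F' E']

theorem contMDiffAt_clm_of_apply {T : M → F →L[ℝ] F'} {x : M}
    (h : ∀ w, ContMDiffAt I 𝓘(ℝ, F') ∞ (fun y ↦ T y w) x) :
    ContMDiffAt I 𝓘(ℝ, F →L[ℝ] F') ∞ T x := by
  let b := finBasis ℝ F
  let S (i) := ContinuousLinearMap.smulRightL ℝ F F' (b.coord i).toContinuousLinearMap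
  have hT : T = fun y ↦ ∑ i, S i (T y (b i)) := by
    ext y w
    conv_lhs => rw [← b.sum_repr w]
    simp [S, -Basis.sum_repr]
  rw [hT]
  exact contMDiffAt_finsetSum fun i _ ↦ (S i).contMDiff.contMDiffAt.comp x (h (b i))

variable [ContMDiffVectorBundle ∞ F E I] [FiniteDimensional ℝ EM] [T2Space M] [IsManifold I ∞ M]

theorem contMDiff_hom_of_apply_section {a : ∀ x, E x →L[ℝ] E' x}
    (h : ∀ σ : Cₛ^∞⟮I; F, E⟯,
      ContMDiff I (I.prod 𝓘(ℝ, F')) ∞ fun x ↦ TotalSpace.mk' F' x (a x (σ x))) :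
    ContMDiff I (I.prod 𝓘(ℝ, F →L[ℝ] F')) ∞
      fun x ↦ TotalSpace.mk' (F →L[ℝ] F') (E := fun x ↦ E x →L[ℝ] E' x) x (a x) := by
  intro x
  rw [contMDiffAt_hom_bundle]
  refine ⟨contMDiffAt_id, contMDiffAt_clm_of_apply fun w ↦ ?_⟩
  obtain ⟨σ, hσ⟩ := exists_section_eventuallyEq_symm (I := I) (E := E) x w
  let e := trivializationAt F E x
  let e' := trivializationAt F' E' x
  refine ((contMDiffAt_section x).1 (h σ x)).congr_of_eventuallyEq ?_
  filter_upwards [hσ, e.open_baseSet.mem_nhds (mem_baseSet_trivializationAt F E x),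
    e'.open_baseSet.mem_nhds (mem_baseSet_trivializationAt F' E' x)] with y hσy hy hy'
  rw [hσy]
  change e'.continuousLinearMapAt ℝ y (a y (e.symmL ℝ y w)) = _
  rw [Trivialization.symmL_apply _ hy, Trivialization.continuousLinearMapAt_apply,
    Trivialization.coe_linearMapAt_of_mem _ hy']

theorem exists_anchor_of_derivation [I.Boundaryless]
    (B : Cₛ^∞⟮I; F, E⟯ →ₗ[ℝ] Derivation ℝ C^∞⟮I, M; 𝓘(ℝ), ℝ⟯ C^∞⟮I, M; 𝓘(ℝ), ℝ⟯)
    (hB : ∀ f σ, B (ContMDiffSection.funSMul f σ) = f • B σ) :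
    ∃ a : Cₛ^∞⟮I; F →L[ℝ] EM, fun x ↦ E x →L[ℝ] TangentSpace I x⟯,
      ∀ σ f x, differential I f x (a x (σ x)) = B σ f x := by
  choose X hX using fun x σ ↦ exists_tangent_of_pointDerivation (Derivation.evalAt x (B σ))
  replace hX (x σ f) : differential I f x (X x σ) = B σ f x := (hX x σ f).symm
  let T (x : M) : Cₛ^∞⟮I; F, E⟯ →ₗ[ℝ] TangentSpace I x :=
    { toFun := X x
      map_add' := fun σ τ ↦ eq_of_differential_apply_eq fun f ↦ by
        rw [hX, map_add, map_add, hX, hX]; rfl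
      map_smul' := fun c σ ↦ eq_of_differential_apply_eq fun f ↦ by
        rw [hX, map_smul, map_smul, hX]; rfl }
  have hT (x f σ) : T x (ContMDiffSection.funSMul f σ) = f x • T x σ :=
    eq_of_differential_apply_eq fun g ↦ by
      rw [map_smul]
      change differential I g x (X x _) = f x • differential I g x (X x σ)
      rw [hX, hX, hB]
      rfl
  choose a ha using fun x ↦ exists_clm_apply_eq_of_map_funSMul (hT x)
  have haB (σ f x) : differential I f x (a x (σ x)) = B σ f x := by rw [ha]; exact hX x σ f
  refine ⟨⟨a, contMDiff_hom_of_apply_section fun σ ↦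
    contMDiff_of_contMDiff_differential_apply fun f ↦ ?_⟩, haB⟩
  simp only [haB]
  exact (B σ f).contMDiff

end BundleMaps

theorem differential_comp_eq_zero {EN : Type*} [NormedAddCommGroup EN] [NormedSpace ℝ EN]
    {HN : Type*} [TopologicalSpace HN] {J : ModelWithCorners ℝ EN HN}
    {N : Type*} [TopologicalSpace N] [ChartedSpace HN N]
    {EN' : Type*} [NormedAddCommGroup EN'] [NormedSpace ℝ EN']
    {HN' : Type*} [TopologicalSpace HN'] {J' : ModelWithCorners ℝ EN' HN'}
    {N' : Type*} [TopologicalSpace N'] [ChartedSpace HN' N']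
    {f : C^∞⟮J, N; 𝓘(ℝ), ℝ⟯} {k : C^∞⟮J', N'; J, N⟯} {x : N'} {y : N} (hk : k x = y)
    (h : differential J f y = 0) : differential J' (f.comp k) x = 0 := by
  subst hk
  rw [differential_comp, h, ContinuousLinearMap.zero_comp]

theorem eq_zero_of_forall_dualBundle_apply_eq_zero {M : Type*} [TopologicalSpace M]
    (F : Type*) [NormedAddCommGroup F] [NormedSpace ℝ F]
    {E : M → Type*} [TopologicalSpace (TotalSpace F E)] [∀ x, AddCommGroup (E x)]
    [∀ x, Module ℝ (E x)] [∀ x, TopologicalSpace (E x)] [FiberBundle F E] [VectorBundle ℝ F E]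
    {x : M} {v : E x} (h : ∀ ξ : DualBundle E x, ξ v = 0) : v = 0 := by
  let e := (trivializationAt F E x).continuousLinearEquivAt ℝ x (mem_baseSet_trivializationAt F E x)
  have hv : e v = 0 := SeparatingDual.eq_zero_of_forall_dual_eq_zero (R := ℝ) fun α ↦
    h (α.comp (e : E x →L[ℝ] F))
  exact e.injective (hv.trans (map_zero e).symm)

section FunctionsOnTotalSpaces

variable {EM : Type*} [NormedAddCommGroup EM] [NormedSpace ℝ EM]
  {HM : Type*} [TopologicalSpace HM] {I : ModelWithCorners ℝ EM HM}
  {M : Type*} [TopologicalSpace M] [ChartedSpace HM M]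
  {F : Type*} [NormedAddCommGroup F] [NormedSpace ℝ F]
  {E : M → Type*} [TopologicalSpace (TotalSpace F E)]
  [∀ x, TopologicalSpace (E x)] [FiberBundle F E]

variable (F E) in
/-- The pull-back `p^* f = f ∘ p` of functions along the projection `p` of a vector bundle. -/
def basePullback :
    C^∞⟮I, M; 𝓘(ℝ), ℝ⟯ →ₐ[ℝ] C^∞⟮I.prod 𝓘(ℝ, F), TotalSpace F E; 𝓘(ℝ), ℝ⟯ where
  toFun f := f.comp ⟨TotalSpace.proj, contMDiff_proj E⟩
  map_one' := rfl
  map_mul' _ _ := rfl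
  map_zero' := rfl
  map_add' _ _ := rfl
  commutes' _ := rfl

theorem differential_basePullback (f : C^∞⟮I, M; 𝓘(ℝ), ℝ⟯) (v : TotalSpace F E) :
    differential (I.prod 𝓘(ℝ, F)) (basePullback F E f) v =
      (differential I f v.proj).comp (mfderiv (I.prod 𝓘(ℝ, F)) I TotalSpace.proj v) :=
  differential_comp f ⟨TotalSpace.proj, contMDiff_proj E⟩ v

/-- A section of a vector bundle, as a smooth map into the total space. -/
def sectionMap (s : Cₛ^∞⟮I; F, E⟯) : C^∞⟮I, M; I.prod 𝓘(ℝ, F), TotalSpace F E⟯ :=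
  ⟨fun x ↦ ⟨x, s x⟩, s.contMDiff⟩

variable [∀ x, AddCommGroup (E x)] [∀ x, Module ℝ (E x)] [VectorBundle ℝ F E]
  [ContMDiffVectorBundle ∞ F E I]

theorem hasDerivAt_fiber_line_of_differential_eq_zero
    {f : C^∞⟮I.prod 𝓘(ℝ, F), TotalSpace F E; 𝓘(ℝ), ℝ⟯} {x : M} {v : E x}
    (h : differential (I.prod 𝓘(ℝ, F)) f ⟨x, v⟩ = 0) (w : E x) :
    HasDerivAt (fun t : ℝ ↦ f ⟨x, v + t • w⟩) 0 0 := by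
  let k : C^∞⟮𝓘(ℝ), ℝ; I.prod 𝓘(ℝ, F), TotalSpace F E⟯ := ⟨_, contMDiff_mk_add_smul v w⟩
  have hk : k 0 = ⟨x, v⟩ := congrArg (TotalSpace.mk x) (by rw [zero_smul, add_zero])
  have hderiv : fderiv ℝ (f.comp k) 0 = 0 := by
    rw [← mfderiv_eq_fderiv]
    exact differential_comp_eq_zero hk h
  have hd : DifferentiableAt ℝ (f.comp k) 0 :=
    ((f.comp k).contMDiff.contDiff.differentiable (by simp)) 0
  have hline := hd.hasFDerivAt.hasDerivAt
  rwa [hderiv] at hline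

theorem eq_zero_of_mfderiv_proj_eq_zero [IsManifold I ∞ M] {v : TotalSpace F E}
    {X : TangentSpace (I.prod 𝓘(ℝ, F)) v}
    (hbase : mfderiv (I.prod 𝓘(ℝ, F)) I TotalSpace.proj v X = 0)
    (hfiber : mfderiv (I.prod 𝓘(ℝ, F)) 𝓘(ℝ, F)
      (fun w ↦ (trivializationAt F E v.proj w).2) v X = 0) : X = 0 := by
  let e := trivializationAt F E v.proj
  have hv : v ∈ e.source := e.mem_source.2 (mem_baseSet_trivializationAt F E v.proj)
  have he : e.toOpenPartialHomeomorph.MDifferentiable (I.prod 𝓘(ℝ, F)) (I.prod 𝓘(ℝ, F)) :=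
    ⟨(e.contMDiffOn (IB := I) (n := ∞)).mdifferentiableOn (by simp),
      (e.contMDiffOn_symm (IB := I) (n := ∞)).mdifferentiableOn (by simp)⟩
  have hfst : (Prod.fst ∘ e : TotalSpace F E → M) =ᶠ[𝓝 v] TotalSpace.proj :=
    (e.open_source.eventually_mem hv).mono fun w hw ↦ e.coe_fst hw
  refine he.mfderiv_injective hv (Eq.trans ?_ (map_zero _).symm)
  have h1 := mfderiv_comp v mdifferentiableAt_fst (he.mdifferentiableAt hv)
  have h2 := mfderiv_comp v mdifferentiableAt_snd (he.mdifferentiableAt hv)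
  rw [mfderiv_fst] at h1
  rw [mfderiv_snd] at h2
  exact Prod.ext ((DFunLike.congr_fun h1 X).symm.trans
    ((DFunLike.congr_fun hfst.mfderiv_eq X).trans hbase))
    ((DFunLike.congr_fun h2 X).symm.trans hfiber)

end FunctionsOnTotalSpaces

section LinearFunctions

variable {EM : Type*} [NormedAddCommGroup EM] [NormedSpace ℝ EM]
  {HM : Type*} [TopologicalSpace HM] {I : ModelWithCorners ℝ EM HM}
  {M : Type*} [TopologicalSpace M] [ChartedSpace HM M]
  {F : Type*} [NormedAddCommGroup F] [NormedSpace ℝ F]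
  {E : M → Type*} [TopologicalSpace (TotalSpace F E)]
  [∀ x, AddCommGroup (E x)] [∀ x, Module ℝ (E x)] [∀ x, TopologicalSpace (E x)]
  [FiberBundle F E] [VectorBundle ℝ F E]

theorem trivializationAt_dualBundle_apply {x : M} {ξ : TotalSpace (F →L[ℝ] ℝ) (DualBundle E)}
    (hξ : ξ.proj ∈ (trivializationAt F E x).baseSet) (w : F) :
    (trivializationAt (F →L[ℝ] ℝ) (DualBundle E) x ξ).2 w =
      ξ.2 ((trivializationAt F E x).symm ξ.proj w) := by
  rw [hom_trivializationAt_apply]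
  change (Bundle.Trivial.trivialization M ℝ).continuousLinearMapAt ℝ ξ.proj
    (ξ.2 ((trivializationAt F E x).symmL ℝ ξ.proj w)) = _
  rw [Trivialization.symmL_apply _ hξ, Bundle.Trivial.continuousLinearMapAt_trivialization]
  rfl

variable [ContMDiffVectorBundle ∞ F E I]

@[simp]
theorem linearFunction_apply (σ : Cₛ^∞⟮I; F, E⟯) (ξ : TotalSpace (F →L[ℝ] ℝ) (DualBundle E)) :
    linearFunction σ ξ = ξ.2 (σ ξ.proj) := rfl

theorem linearFunction_zero : linearFunction (0 : Cₛ^∞⟮I; F, E⟯) = 0 :=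
  ContMDiffMap.ext fun ξ ↦ map_zero ξ.2

theorem linearFunction_add (σ τ : Cₛ^∞⟮I; F, E⟯) :
    linearFunction (σ + τ) = linearFunction σ + linearFunction τ :=
  ContMDiffMap.ext fun ξ ↦ map_add ξ.2 (σ ξ.proj) (τ ξ.proj)

theorem linearFunction_funSMul (f : C^∞⟮I, M; 𝓘(ℝ), ℝ⟯) (σ : Cₛ^∞⟮I; F, E⟯) :
    linearFunction (ContMDiffSection.funSMul f σ) =
      basePullback (F →L[ℝ] ℝ) (DualBundle E) f * linearFunction σ := by
  ext ξ
  exact map_smul ξ.2 _ _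

variable (I F E) in
/-- The map `σ ↦ φ_σ`, from sections of `E` to functions on the total space of `E*`. -/
def linearFunctionₗ : Cₛ^∞⟮I; F, E⟯ →ₗ[ℝ]
    C^∞⟮I.prod 𝓘(ℝ, F →L[ℝ] ℝ), TotalSpace (F →L[ℝ] ℝ) (DualBundle E); 𝓘(ℝ), ℝ⟯ where
  toFun := linearFunction
  map_add' := linearFunction_add
  map_smul' c σ := ContMDiffMap.ext fun ξ ↦ map_smul ξ.2 c (σ ξ.proj)

variable (I F E) in
/-- The function `φ_σ + u ∘ p` on the total space of `E*`, for a section `σ` of `E` and a smooth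
function `u` on the base. -/
def affineFunction : Cₛ^∞⟮I; F, E⟯ × C^∞⟮I, M; 𝓘(ℝ), ℝ⟯ →ₗ[ℝ]
    C^∞⟮I.prod 𝓘(ℝ, F →L[ℝ] ℝ), TotalSpace (F →L[ℝ] ℝ) (DualBundle E); 𝓘(ℝ), ℝ⟯ :=
  (linearFunctionₗ I F E).coprod (basePullback (F →L[ℝ] ℝ) (DualBundle E)).toLinearMap

theorem affineFunction_eq (σ : Cₛ^∞⟮I; F, E⟯) (u : C^∞⟮I, M; 𝓘(ℝ), ℝ⟯) :
    affineFunction I F E (σ, u) =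
      linearFunction σ + basePullback (F →L[ℝ] ℝ) (DualBundle E) u := rfl

theorem affineFunction_inl (σ : Cₛ^∞⟮I; F, E⟯) :
    affineFunction I F E (σ, 0) = linearFunction σ := by
  rw [affineFunction_eq, map_zero, add_zero]

theorem affineFunction_inr (f : C^∞⟮I, M; 𝓘(ℝ), ℝ⟯) :
    affineFunction I F E (0, f) = basePullback (F →L[ℝ] ℝ) (DualBundle E) f := by
  rw [affineFunction_eq, linearFunction_zero, zero_add]

theorem apply_eq_zero_of_differential_affineFunction_eq_zero
    {ξ : TotalSpace (F →L[ℝ] ℝ) (DualBundle E)} {σ : Cₛ^∞⟮I; F, E⟯} {u : C^∞⟮I, M; 𝓘(ℝ), ℝ⟯}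
    (h : differential (I.prod 𝓘(ℝ, F →L[ℝ] ℝ)) (affineFunction I F E (σ, u)) ξ = 0) :
    σ ξ.proj = 0 := by
  refine eq_zero_of_forall_dualBundle_apply_eq_zero F fun η ↦ ?_
  have hline : HasDerivAt (fun t : ℝ ↦ ξ.2 (σ ξ.proj) + t * η (σ ξ.proj) + u ξ.proj) 0 0 :=
    hasDerivAt_fiber_line_of_differential_eq_zero h η
  have hline' := ((((hasDerivAt_id (0 : ℝ)).mul_const (η (σ ξ.proj))).const_add
    (ξ.2 (σ ξ.proj))).add_const (u ξ.proj)).unique hline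
  rwa [one_mul] at hline'

theorem differential_comp_sectionMap_of_differential_affineFunction_eq_zero
    {s : Cₛ^∞⟮I; F →L[ℝ] ℝ, DualBundle E⟯} {σ : Cₛ^∞⟮I; F, E⟯} {u : C^∞⟮I, M; 𝓘(ℝ), ℝ⟯} {x : M}
    (h : differential (I.prod 𝓘(ℝ, F →L[ℝ] ℝ)) (affineFunction I F E (σ, u)) ⟨x, s x⟩ = 0) :
    differential I ((linearFunction σ).comp (sectionMap s)) x = -differential I u x := by
  have hsum := differential_comp_eq_zero (k := sectionMap s) rfl h
  exact eq_neg_of_add_eq_zero_left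
    ((differential_add ((linearFunction σ).comp (sectionMap s)) u x).symm.trans hsum)

theorem exists_dualBundle_ne_zero {M : Type*} [TopologicalSpace M]
    (F : Type*) [NormedAddCommGroup F] [NormedSpace ℝ F] [Nontrivial F]
    {E : M → Type*} [TopologicalSpace (TotalSpace F E)] [∀ x, AddCommGroup (E x)]
    [∀ x, Module ℝ (E x)] [∀ x, TopologicalSpace (E x)] [FiberBundle F E] [VectorBundle ℝ F E]
    (x : M) : ∃ ξ : DualBundle E x, ξ ≠ 0 := by
  let e := (trivializationAt F E x).continuousLinearEquivAt ℝ x (mem_baseSet_trivializationAt F E x)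
  obtain ⟨v, hv⟩ := exists_ne (0 : F)
  by_contra! h
  have hev : e.symm v = 0 := eq_zero_of_forall_dualBundle_apply_eq_zero F fun ξ ↦ by rw [h ξ]; rfl
  exact hv (e.symm.injective (hev.trans (map_zero e.symm).symm))

theorem eq_zero_of_mul_linearFunction_eq_zero [T2Space M] [FiniteDimensional ℝ EM]
    [IsManifold I ∞ M] [Nontrivial F]
    {h : C^∞⟮I.prod 𝓘(ℝ, F →L[ℝ] ℝ), TotalSpace (F →L[ℝ] ℝ) (DualBundle E); 𝓘(ℝ), ℝ⟯}
    (hh : ∀ σ : Cₛ^∞⟮I; F, E⟯, h * linearFunction σ = 0) : h = 0 := by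
  have hne : ∀ {x : M} {η : DualBundle E x}, η ≠ 0 → h ⟨x, η⟩ = 0 := by
    intro x η hη
    obtain ⟨w, hw⟩ := DFunLike.ne_iff.1 hη
    obtain ⟨σ, rfl⟩ := exists_section_apply_eq I F x w
    exact (mul_eq_zero.1 (DFunLike.congr_fun (hh σ) (⟨x, η⟩ : TotalSpace _ _))).resolve_right hw
  ext ⟨x, ξ⟩
  by_cases hξ : ξ = 0
  · obtain ⟨η, hη⟩ := exists_dualBundle_ne_zero F (E := E) x
    have hline : Continuous fun t : ℝ ↦ h ⟨x, 0 + t • η⟩ :=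
      h.contMDiff.continuous.comp (contMDiff_mk_add_smul (I := I) 0 η).continuous
    have hzero : (fun t : ℝ ↦ h ⟨x, 0 + t • η⟩) = fun _ ↦ 0 :=
      hline.ext_on (dense_compl_singleton 0) continuous_const fun t ht ↦
        hne (by rw [zero_add]; exact smul_ne_zero ht hη)
    have h0 : h ⟨x, 0 + (0 : ℝ) • η⟩ = 0 := congrFun hzero 0
    rw [hξ]
    rwa [zero_smul, add_zero] at h0
  · exact hne hξ

variable [FiniteDimensional ℝ EM] [T2Space M] [IsManifold I ∞ M]

theorem exists_linearFunction_eventuallyEq (ξ : TotalSpace (F →L[ℝ] ℝ) (DualBundle E)) (w : F) :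
    ∃ σ : Cₛ^∞⟮I; F, E⟯, linearFunction σ =ᶠ[𝓝 ξ]
      fun η ↦ (trivializationAt (F →L[ℝ] ℝ) (DualBundle E) ξ.proj η).2 w := by
  obtain ⟨σ, hσ⟩ := exists_section_eventuallyEq_symm (I := I) (E := E) ξ.proj w
  have hp := (FiberBundle.continuous_proj (F →L[ℝ] ℝ) (DualBundle E)).continuousAt (x := ξ)
  refine ⟨σ, ?_⟩
  filter_upwards [hp.eventually hσ,
    hp.eventually ((trivializationAt F E ξ.proj).open_baseSet.mem_nhds
      (mem_baseSet_trivializationAt F E ξ.proj))] with η hη hbase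
  rw [linearFunction_apply, hη, trivializationAt_dualBundle_apply hbase]

theorem differentialsExhaust_affineFunction [I.Boundaryless] [FiniteDimensional ℝ F] :
    DifferentialsExhaust (affineFunction I F E) := by
  refine differentialsExhaust_of_separating _ fun ξ X hX ↦ ?_
  refine eq_zero_of_mfderiv_proj_eq_zero ?_ ?_
  · refine eq_of_differential_apply_eq fun f ↦ ?_
    have hf := hX (0, f)
    rw [affineFunction_inr, differential_basePullback] at hf
    exact hf.trans (map_zero (differential I f ξ.proj)).symm
  · let e := trivializationAt (F →L[ℝ] ℝ) (DualBundle E) ξ.proj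
    have he : MDifferentiableAt (I.prod 𝓘(ℝ, F →L[ℝ] ℝ)) 𝓘(ℝ, F →L[ℝ] ℝ) (fun η ↦ (e η).2) ξ :=
      (contMDiffAt_totalSpace.1 (contMDiff_id (n := ∞) ξ)).2.mdifferentiableAt (by simp)
    refine ContinuousLinearMap.ext fun w ↦ ?_
    obtain ⟨σ, hσ⟩ := exists_linearFunction_eventuallyEq (I := I) ξ w
    have hw := hσ.mfderiv_eq (I := I.prod 𝓘(ℝ, F →L[ℝ] ℝ)) (I' := 𝓘(ℝ))
    let ev : (F →L[ℝ] ℝ) →L[ℝ] ℝ := ContinuousLinearMap.apply ℝ ℝ w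
    have hcomp := mfderiv_comp ξ ev.mdifferentiableAt he
    rw [ContinuousLinearMap.mfderiv_eq] at hcomp
    have hX' := hX (σ, 0)
    rw [affineFunction_inl] at hX'
    exact (DFunLike.congr_fun (hw.trans hcomp) X).symm.trans hX'

end LinearFunctions

section PullbackOfBivectors

variable {EN : Type*} [NormedAddCommGroup EN] [NormedSpace ℝ EN]
  {HN : Type*} [TopologicalSpace HN] {J : ModelWithCorners ℝ EN HN}
  {N : Type*} [TopologicalSpace N] [ChartedSpace HN N]
  {κ : C^∞⟮J, N; J, N⟯} {x : N} (hκ : (mfderiv J J κ x).IsInvertible)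
include hκ

theorem PoissonStructure.HasBivector.pullback_apply {P : PoissonStructure J N}
    {u : MultivectorField J N 2} (hu : PoissonStructure.HasBivector J P u)
    (f g : C^∞⟮J, N; 𝓘(ℝ), ℝ⟯) :
    MultivectorField.pullback J κ u x
      ![differential J (f.comp κ) x, differential J (g.comp κ) x] = P.bracket f g (κ x) := by
  have hpush (f : C^∞⟮J, N; 𝓘(ℝ), ℝ⟯) : (differential J (f.comp κ) x).comp
      (mfderiv J J κ x).inverse = differential J f (κ x) := by
    rw [differential_comp, ContinuousLinearMap.comp_assoc, hκ.self_comp_inverse,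
      ContinuousLinearMap.comp_id]
  rw [← hu, ← hpush f, ← hpush g]
  refine congrArg (u (κ x)) (funext fun i ↦ ?_)
  fin_cases i <;> rfl

theorem DifferentialsExhaust.exists_differential_comp_eq {L : Type*}
    {D : L → C^∞⟮J, N; 𝓘(ℝ), ℝ⟯} (hD : DifferentialsExhaust D) (α : CotangentSpace J x) :
    ∃ l, differential J ((D l).comp κ) x = α := by
  obtain ⟨l, hl⟩ := hD (κ x) (α.comp (mfderiv J J κ x).inverse)
  dsimp only at hl
  refine ⟨l, ?_⟩
  rw [differential_comp, hl, ContinuousLinearMap.comp_assoc, hκ.inverse_comp_self,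
    ContinuousLinearMap.comp_id]

end PullbackOfBivectors

theorem fiberScaling_inv_fiberScaling {M F : Type*} {E : M → Type*} [∀ x, AddCommGroup (E x)]
    [∀ x, Module ℝ (E x)] {t : ℝ} (ht : t ≠ 0) (v : TotalSpace F E) :
    fiberScaling F t⁻¹ (fiberScaling F t v) = v :=
  congrArg (TotalSpace.mk v.proj) (inv_smul_smul₀ ht v.2)

section Homogeneity

variable {EM : Type*} [NormedAddCommGroup EM] [NormedSpace ℝ EM]
  {HM : Type*} [TopologicalSpace HM] {I : ModelWithCorners ℝ EM HM}
  {M : Type*} [TopologicalSpace M] [ChartedSpace HM M]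
  {F : Type*} [NormedAddCommGroup F] [NormedSpace ℝ F]
  {E : M → Type*} [TopologicalSpace (TotalSpace F E)]
  [∀ x, AddCommGroup (E x)] [∀ x, Module ℝ (E x)] [∀ x, TopologicalSpace (E x)]
  [FiberBundle F E]

/-- A function `f` on the total space of a vector bundle is homogeneous of degree `k` if
`f ∘ κ_t = t ^ k f` for all `t ≠ 0`; negative degrees are allowed because the Poisson bracket of a
linear Poisson structure has degree `-1`. -/
def IsFiberwiseHomogeneous (k : ℤ) (f : C^∞⟮I.prod 𝓘(ℝ, F), TotalSpace F E; 𝓘(ℝ), ℝ⟯) : Prop :=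
  ∀ t : ℝ, t ≠ 0 → ∀ v, f (fiberScaling F t v) = t ^ k * f v

theorem isFiberwiseHomogeneous_basePullback (f : C^∞⟮I, M; 𝓘(ℝ), ℝ⟯) :
    IsFiberwiseHomogeneous 0 (basePullback F E f) := fun t _ v ↦ by
  rw [zpow_zero, one_mul]
  rfl

variable [VectorBundle ℝ F E]

variable (I F E) in
/-- The scalar multiplication `κ_t` as a smooth map. -/
def fiberScalingMap (t : ℝ) :
    C^∞⟮I.prod 𝓘(ℝ, F), TotalSpace F E; I.prod 𝓘(ℝ, F), TotalSpace F E⟯ :=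
  ⟨fiberScaling F t, contMDiff_fiberScaling t⟩

theorem continuous_apply_fiberScaling [ContMDiffVectorBundle ∞ F E I]
    (f : C^∞⟮I.prod 𝓘(ℝ, F), TotalSpace F E; 𝓘(ℝ), ℝ⟯) (v : TotalSpace F E) :
    Continuous fun t : ℝ ↦ f (fiberScaling F t v) := by
  have h := f.contMDiff.continuous.comp (contMDiff_mk_add_smul (I := I) 0 v.2).continuous
  simp only [zero_add] at h
  exact h

theorem isInvertible_mfderiv_fiberScalingMap {t : ℝ} (ht : t ≠ 0) (v : TotalSpace F E) :
    (mfderiv (I.prod 𝓘(ℝ, F)) (I.prod 𝓘(ℝ, F)) (fiberScalingMap I F E t) v).IsInvertible := by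
  let Φ : TotalSpace F E ≃ₘ^∞⟮I.prod 𝓘(ℝ, F), I.prod 𝓘(ℝ, F)⟯ TotalSpace F E :=
    { toFun := fiberScaling F t
      invFun := fiberScaling F t⁻¹
      left_inv := fiberScaling_inv_fiberScaling ht
      right_inv v := by
        simpa only [inv_inv] using fiberScaling_inv_fiberScaling (inv_ne_zero ht) v
      contMDiff_toFun := contMDiff_fiberScaling t
      contMDiff_invFun := contMDiff_fiberScaling t⁻¹ }
  exact ⟨Φ.mfderivToContinuousLinearEquiv (by simp) v, rfl⟩

theorem PoissonStructure.IsFiberwiseLinear.bracket_comp_fiberScalingMap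
    {P : PoissonStructure (I.prod 𝓘(ℝ, F)) (TotalSpace F E)} (hP : P.IsFiberwiseLinear I) {t : ℝ}
    (ht : t ≠ 0) (f g : C^∞⟮I.prod 𝓘(ℝ, F), TotalSpace F E; 𝓘(ℝ), ℝ⟯) :
    P.bracket (f.comp (fiberScalingMap I F E t)) (g.comp (fiberScalingMap I F E t)) =
      t • (P.bracket f g).comp (fiberScalingMap I F E t) := by
  obtain ⟨u, hu, hlin⟩ := hP
  ext v
  have hscale : P.bracket f g (fiberScaling F t v) = t ^ (1 - ((2 : ℕ) : ℤ)) *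
      P.bracket (f.comp (fiberScalingMap I F E t)) (g.comp (fiberScalingMap I F E t)) v := by
    rw [← hu (f.comp _)]
    exact (hu.pullback_apply (isInvertible_mfderiv_fiberScalingMap ht v) f g).symm.trans
      (DFunLike.congr_fun (congrFun (hlin t ht) v) _)
  change _ = t * P.bracket f g (fiberScaling F t v)
  rw [hscale, ← mul_assoc, ← zpow_one_add₀ ht]
  norm_num

theorem isFiberwiseLinear_of_bracket_comp_fiberScalingMap [I.Boundaryless] [IsManifold I ∞ M]
    [T2Space M] [FiniteDimensional ℝ EM] [FiniteDimensional ℝ F] [ContMDiffVectorBundle ∞ F E I]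
    {P : PoissonStructure (I.prod 𝓘(ℝ, F)) (TotalSpace F E)}
    {L : Type*} {D : L → C^∞⟮I.prod 𝓘(ℝ, F), TotalSpace F E; 𝓘(ℝ), ℝ⟯}
    (hD : DifferentialsExhaust D)
    (h : ∀ t : ℝ, t ≠ 0 → ∀ l l',
      P.bracket ((D l).comp (fiberScalingMap I F E t)) ((D l').comp (fiberScalingMap I F E t)) =
        t • (P.bracket (D l) (D l')).comp (fiberScalingMap I F E t)) :
    P.IsFiberwiseLinear I := by
  have : T2Space (TotalSpace F E) := t2Space_totalSpace
  obtain ⟨u, hu⟩ := P.exists_hasBivector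
  refine ⟨u, hu, fun t ht ↦ funext fun v ↦ AlternatingMap.ext fun α ↦ ?_⟩
  have hinv := isInvertible_mfderiv_fiberScalingMap (I := I) ht v
  obtain ⟨l, hl⟩ := hD.exists_differential_comp_eq hinv (α 0)
  obtain ⟨l', hl'⟩ := hD.exists_differential_comp_eq hinv (α 1)
  have hα : α = ![differential _ ((D l).comp (fiberScalingMap I F E t)) v,
      differential _ ((D l').comp (fiberScalingMap I F E t)) v] := by
    rw [hl, hl']
    exact (List.ofFn_inj.1 rfl)
  rw [hα]
  refine (hu.pullback_apply hinv (D l) (D l')).trans ?_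
  change P.bracket (D l) (D l') (fiberScaling F t v) = t ^ (1 - ((2 : ℕ) : ℤ)) * u v _
  rw [hu, h t ht]
  change _ = _ * (t * P.bracket (D l) (D l') (fiberScaling F t v))
  rw [← mul_assoc, ← zpow_add_one₀ ht]
  norm_num

namespace IsFiberwiseHomogeneous

variable {f g : C^∞⟮I.prod 𝓘(ℝ, F), TotalSpace F E; 𝓘(ℝ), ℝ⟯}

theorem comp_fiberScalingMap {k : ℤ} (hf : IsFiberwiseHomogeneous k f) {t : ℝ} (ht : t ≠ 0) :
    f.comp (fiberScalingMap I F E t) = t ^ k • f :=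
  DFunLike.ext _ _ (hf t ht)

theorem bracket {P : PoissonStructure (I.prod 𝓘(ℝ, F)) (TotalSpace F E)}
    (hP : P.IsFiberwiseLinear I) {j k : ℤ} (hf : IsFiberwiseHomogeneous j f)
    (hg : IsFiberwiseHomogeneous k g) : IsFiberwiseHomogeneous (j + k - 1) (P.bracket f g) := by
  intro t ht v
  have h := hP.bracket_comp_fiberScalingMap ht f g
  rw [hf.comp_fiberScalingMap ht, hg.comp_fiberScalingMap ht, map_smul, map_smul,
    LinearMap.smul_apply] at h
  have hv : t ^ k * (t ^ j * P.bracket f g v) = t * P.bracket f g (fiberScaling F t v) :=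
    DFunLike.congr_fun h v
  rw [← mul_right_inj' ht, ← hv, ← mul_assoc, ← mul_assoc, ← zpow_add₀ ht, ← zpow_one_add₀ ht]
  congr 2
  ring

variable [ContMDiffVectorBundle ∞ F E I]

theorem apply_fiberScaling {n : ℕ} (hf : IsFiberwiseHomogeneous n f) (t : ℝ) (v : TotalSpace F E) :
    f (fiberScaling F t v) = t ^ n * f v := by
  have hline := continuous_apply_fiberScaling f v
  exact congrFun (hline.ext_on (dense_compl_singleton 0)
    ((continuous_pow n).mul_const (f v)) fun s hs ↦
      (hf s hs v).trans (by rw [zpow_natCast])) t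

theorem eq_zero {k : ℤ} (hk : k < 0) (hf : IsFiberwiseHomogeneous k f) : f = 0 := by
  obtain ⟨n, rfl⟩ := Int.exists_eq_neg_ofNat hk.le
  have hn : n ≠ 0 := by lia
  ext v
  have hline := continuous_apply_fiberScaling f v
  have hpow : (fun t : ℝ ↦ t ^ n * f (fiberScaling F t v)) = fun _ ↦ f v :=
    ((continuous_pow n).mul hline).ext_on (dense_compl_singleton 0) continuous_const fun t ht ↦ by
      change t ^ n * f (fiberScaling F t v) = f v
      rw [hf t ht, zpow_neg, zpow_natCast, mul_inv_cancel_left₀ (pow_ne_zero n ht)]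
  have h0 := congrFun hpow 0
  rw [zero_pow hn, zero_mul] at h0
  exact h0.symm

end IsFiberwiseHomogeneous

theorem PoissonStructure.IsFiberwiseLinear.bracket_basePullback_basePullback
    [ContMDiffVectorBundle ∞ F E I] {P : PoissonStructure (I.prod 𝓘(ℝ, F)) (TotalSpace F E)}
    (hP : P.IsFiberwiseLinear I) (f g : C^∞⟮I, M; 𝓘(ℝ), ℝ⟯) :
    P.bracket (basePullback F E f) (basePullback F E g) = 0 :=
  IsFiberwiseHomogeneous.eq_zero (by norm_num)
    (.bracket hP (isFiberwiseHomogeneous_basePullback f) (isFiberwiseHomogeneous_basePullback g))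

theorem affineFunction_comp_fiberScalingMap [ContMDiffVectorBundle ∞ F E I] (t : ℝ)
    (σ : Cₛ^∞⟮I; F, E⟯) (u : C^∞⟮I, M; 𝓘(ℝ), ℝ⟯) :
    (affineFunction I F E (σ, u)).comp (fiberScalingMap I (F →L[ℝ] ℝ) (DualBundle E) t) =
      affineFunction I F E (t • σ, u) := by
  ext ξ
  exact congrArg (· + u ξ.proj) (map_smul ξ.2 t (σ ξ.proj)).symm

end Homogeneity

theorem subsingleton_fiber {M : Type*} [TopologicalSpace M]
    (F : Type*) [NormedAddCommGroup F] [NormedSpace ℝ F] [Subsingleton F]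
    {E : M → Type*} [TopologicalSpace (TotalSpace F E)] [∀ x, AddCommGroup (E x)]
    [∀ x, Module ℝ (E x)] [∀ x, TopologicalSpace (E x)] [FiberBundle F E] [VectorBundle ℝ F E]
    (x : M) : Subsingleton (E x) :=
  ((trivializationAt F E x).continuousLinearEquivAt ℝ x
    (mem_baseSet_trivializationAt F E x)).injective.subsingleton

namespace LieAlgebroidStructure

variable {EM : Type*} [NormedAddCommGroup EM] [NormedSpace ℝ EM]
  {HM : Type*} [TopologicalSpace HM] {I : ModelWithCorners ℝ EM HM}
  {M : Type*} [TopologicalSpace M] [ChartedSpace HM M] [IsManifold I ∞ M]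
  {F : Type*} [NormedAddCommGroup F] [NormedSpace ℝ F]
  {E : M → Type*} [TopologicalSpace (TotalSpace F E)]
  [∀ x, AddCommGroup (E x)] [∀ x, Module ℝ (E x)] [∀ x, TopologicalSpace (E x)]
  [FiberBundle F E] [VectorBundle ℝ F E]

section Anchor

variable (A : LieAlgebroidStructure I F E)

theorem bracket_skew (σ τ : Cₛ^∞⟮I; F, E⟯) : A.bracket σ τ = -A.bracket τ σ := by
  have h := A.bracket_self (σ + τ)
  simp only [map_add, LinearMap.add_apply, A.bracket_self, zero_add, add_zero] at h
  exact eq_neg_of_add_eq_zero_right h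

variable [I.Boundaryless]

/-- The action `(σ, f) ↦ a(σ) f` of the sections of a Lie algebroid on functions, through the
anchor. -/
def anchorAction :
    Cₛ^∞⟮I; F, E⟯ →ₗ[ℝ] C^∞⟮I, M; 𝓘(ℝ), ℝ⟯ →ₗ[ℝ] C^∞⟮I, M; 𝓘(ℝ), ℝ⟯ :=
  LinearMap.mk₂ ℝ (fun σ f ↦ ⟨fun x ↦ differential I f x (A.anchor x (σ x)),
      contMDiff_differential_apply f (ContMDiff.clm_bundle_apply (F₁ := F) (F₂ := EM)
        A.anchor.contMDiff σ.contMDiff)⟩)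
    (fun σ τ f ↦ ContMDiffMap.ext fun x ↦
      (congrArg (differential I f x) (map_add (A.anchor x) (σ x) (τ x))).trans (map_add _ _ _))
    (fun c σ f ↦ ContMDiffMap.ext fun x ↦
      (congrArg (differential I f x) (map_smul (A.anchor x) c (σ x))).trans (map_smul _ _ _))
    (fun σ f g ↦ ContMDiffMap.ext fun x ↦
      DFunLike.congr_fun (differential_add f g x) (A.anchor x (σ x)))
    (fun c σ f ↦ ContMDiffMap.ext fun x ↦
      DFunLike.congr_fun (differential_smul c f x) (A.anchor x (σ x)))

theorem anchorAction_apply (σ : Cₛ^∞⟮I; F, E⟯) (f : C^∞⟮I, M; 𝓘(ℝ), ℝ⟯) (x : M) :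
    A.anchorAction σ f x = differential I f x (A.anchor x (σ x)) := rfl

theorem anchorAction_apply_eq_zero {σ : Cₛ^∞⟮I; F, E⟯} {x : M} (h : σ x = 0)
    (f : C^∞⟮I, M; 𝓘(ℝ), ℝ⟯) : A.anchorAction σ f x = 0 := by
  rw [anchorAction_apply, h, map_zero, map_zero]

theorem anchorAction_mul (σ : Cₛ^∞⟮I; F, E⟯) (f g : C^∞⟮I, M; 𝓘(ℝ), ℝ⟯) :
    A.anchorAction σ (f * g) = f * A.anchorAction σ g + g * A.anchorAction σ f := by
  ext x
  exact DFunLike.congr_fun (differential_mul f g x) (A.anchor x (σ x))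

theorem anchorAction_funSMul (f g : C^∞⟮I, M; 𝓘(ℝ), ℝ⟯) (σ : Cₛ^∞⟮I; F, E⟯) :
    A.anchorAction (ContMDiffSection.funSMul f σ) g = f * A.anchorAction σ g := by
  ext x
  exact (congrArg (differential I g x) (map_smul (A.anchor x) (f x) (σ x))).trans (map_smul _ _ _)

theorem bracket_funSMul (σ τ : Cₛ^∞⟮I; F, E⟯) (f : C^∞⟮I, M; 𝓘(ℝ), ℝ⟯) :
    A.bracket σ (ContMDiffSection.funSMul f τ) =
      ContMDiffSection.funSMul f (A.bracket σ τ) +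
        ContMDiffSection.funSMul (A.anchorAction σ f) τ := by
  ext x
  exact A.leibniz σ τ f x

-- Expanding the Jacobi identity for `σ, τ, f ρ` isolates the claim multiplied by `ρ`. At a point
-- where every section vanishes, both sides are zero.
theorem anchorAction_bracket (σ τ : Cₛ^∞⟮I; F, E⟯) (f : C^∞⟮I, M; 𝓘(ℝ), ℝ⟯) :
    A.anchorAction (A.bracket σ τ) f =
      A.anchorAction σ (A.anchorAction τ f) - A.anchorAction τ (A.anchorAction σ f) := by
  ext x
  change _ = A.anchorAction σ (A.anchorAction τ f) x - A.anchorAction τ (A.anchorAction σ f) x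
  by_cases! h : ∃ ρ : Cₛ^∞⟮I; F, E⟯, ρ x ≠ 0
  · obtain ⟨ρ, hρ⟩ := h
    have hfρ := congrArg (· x) (A.jacobi σ τ (ContMDiffSection.funSMul f ρ))
    have hjac := congrArg (· x) (A.jacobi σ τ ρ)
    simp only [bracket_funSMul, map_add, ContMDiffSection.coe_add, Pi.add_apply,
      funSMul_apply] at hfρ hjac
    rw [hjac] at hfρ
    have hsmul : (A.anchorAction (A.bracket σ τ) f x - (A.anchorAction σ (A.anchorAction τ f) x -
        A.anchorAction τ (A.anchorAction σ f) x)) • ρ x = 0 := by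
      linear_combination (norm := module) (-1 : ℝ) • hfρ
    exact sub_eq_zero.1 ((smul_eq_zero.1 hsmul).resolve_right hρ)
  · rw [A.anchorAction_apply_eq_zero (h _), A.anchorAction_apply_eq_zero (h _),
      A.anchorAction_apply_eq_zero (h _), sub_zero]

/-- The Lie bracket of the semidirect product of the sections of a Lie algebroid, acting through
the anchor, with the abelian Lie algebra of smooth functions. -/
def affineBracket :
    (Cₛ^∞⟮I; F, E⟯ × C^∞⟮I, M; 𝓘(ℝ), ℝ⟯) →ₗ[ℝ] (Cₛ^∞⟮I; F, E⟯ × C^∞⟮I, M; 𝓘(ℝ), ℝ⟯) →ₗ[ℝ]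
      (Cₛ^∞⟮I; F, E⟯ × C^∞⟮I, M; 𝓘(ℝ), ℝ⟯) :=
  LinearMap.mk₂ ℝ
    (fun l l' ↦ (A.bracket l.1 l'.1, A.anchorAction l.1 l'.2 - A.anchorAction l'.1 l.2))
    (fun l m l' ↦ Prod.ext (by simp) (by simp; abel))
    (fun c l l' ↦ Prod.ext (by simp) (by simp [smul_sub]))
    (fun l l' m ↦ Prod.ext (by simp) (by simp; abel))
    (fun c l l' ↦ Prod.ext (by simp) (by simp [smul_sub]))

theorem affineBracket_apply (l l' : Cₛ^∞⟮I; F, E⟯ × C^∞⟮I, M; 𝓘(ℝ), ℝ⟯) :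
    A.affineBracket l l' =
      (A.bracket l.1 l'.1, A.anchorAction l.1 l'.2 - A.anchorAction l'.1 l.2) := rfl

theorem affineBracket_self (l : Cₛ^∞⟮I; F, E⟯ × C^∞⟮I, M; 𝓘(ℝ), ℝ⟯) :
    A.affineBracket l l = 0 := by
  rw [affineBracket_apply, A.bracket_self, sub_self]
  rfl

theorem affineBracket_jacobi (l l' l'' : Cₛ^∞⟮I; F, E⟯ × C^∞⟮I, M; 𝓘(ℝ), ℝ⟯) :
    A.affineBracket l (A.affineBracket l' l'') =
      A.affineBracket (A.affineBracket l l') l'' + A.affineBracket l' (A.affineBracket l l'') := by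
  simp only [affineBracket_apply]
  refine Prod.ext (A.jacobi _ _ _) ?_
  simp only [Prod.snd_add, anchorAction_bracket, map_sub]
  abel

end Anchor

variable [I.Boundaryless] [ContMDiffVectorBundle ∞ F E I]

theorem affineFunction_affineBracket_fiberScaling (A : LieAlgebroidStructure I F E) (t : ℝ)
    (σ τ : Cₛ^∞⟮I; F, E⟯) (f g : C^∞⟮I, M; 𝓘(ℝ), ℝ⟯) :
    affineFunction I F E (A.affineBracket (t • σ, f) (t • τ, g)) =
      t • (affineFunction I F E (A.affineBracket (σ, f) (τ, g))).comp
        (fiberScalingMap I (F →L[ℝ] ℝ) (DualBundle E) t) := by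
  simp only [affineBracket_apply, map_smul, LinearMap.smul_apply]
  ext ξ
  change ξ.2 (t • t • A.bracket σ τ ξ.proj) +
      (t * A.anchorAction σ g ξ.proj - t * A.anchorAction τ f ξ.proj) =
    t * (t * ξ.2 (A.bracket σ τ ξ.proj) +
      (A.anchorAction σ g ξ.proj - A.anchorAction τ f ξ.proj))
  rw [map_smul, map_smul, smul_eq_mul, smul_eq_mul]
  ring

section Existence

variable [FiniteDimensional ℝ EM] [T2Space M] [FiniteDimensional ℝ F]
  (A : LieAlgebroidStructure I F E)

theorem apply_bracket_eq_anchorAction_of_apply_eq_zero {σ : Cₛ^∞⟮I; F, E⟯} {x : M} (h : σ x = 0)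
    (s : Cₛ^∞⟮I; F →L[ℝ] ℝ, DualBundle E⟯) (τ : Cₛ^∞⟮I; F, E⟯) :
    s x (A.bracket τ σ x) =
      A.anchorAction τ ((linearFunction σ).comp (sectionMap s)) x := by
  let sφ : Cₛ^∞⟮I; F, E⟯ →ₗ[ℝ] C^∞⟮I, M; 𝓘(ℝ), ℝ⟯ :=
    { toFun σ := (linearFunction σ).comp (sectionMap s)
      map_add' σ ρ := ContMDiffMap.ext fun y ↦ map_add (s y) (σ y) (ρ y)
      map_smul' c σ := ContMDiffMap.ext fun y ↦ map_smul (s y) c (σ y) }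
  have hsφ (f : C^∞⟮I, M; 𝓘(ℝ), ℝ⟯) (σ : Cₛ^∞⟮I; F, E⟯) :
      sφ (ContMDiffSection.funSMul f σ) = f * sφ σ :=
    ContMDiffMap.ext fun y ↦ map_smul (s y) (f y) (σ y)
  let T : Cₛ^∞⟮I; F, E⟯ →ₗ[ℝ] ℝ :=
    evalₗ x ∘ₗ (sφ ∘ₗ A.bracket τ - A.anchorAction τ ∘ₗ sφ)
  have hT (f : C^∞⟮I, M; 𝓘(ℝ), ℝ⟯) (σ : Cₛ^∞⟮I; F, E⟯) :
      T (ContMDiffSection.funSMul f σ) = f x • T σ := by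
    change sφ (A.bracket τ (ContMDiffSection.funSMul f σ)) x -
        A.anchorAction τ (sφ (ContMDiffSection.funSMul f σ)) x =
      f x * (sφ (A.bracket τ σ) x - A.anchorAction τ (sφ σ) x)
    rw [bracket_funSMul, map_add, hsφ, hsφ, hsφ, anchorAction_mul]
    change f x * _ + _ * sφ σ x - (f x * _ + sφ σ x * _) = _
    ring
  exact sub_eq_zero.1 (map_eq_zero_of_map_funSMul hT h)

theorem affineFunction_affineBracket_apply_eq_zero
    {ξ : TotalSpace (F →L[ℝ] ℝ) (DualBundle E)} {l : Cₛ^∞⟮I; F, E⟯ × C^∞⟮I, M; 𝓘(ℝ), ℝ⟯}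
    (h : differential (I.prod 𝓘(ℝ, F →L[ℝ] ℝ)) (affineFunction I F E l) ξ = 0)
    (l' : Cₛ^∞⟮I; F, E⟯ × C^∞⟮I, M; 𝓘(ℝ), ℝ⟯) :
    affineFunction I F E (A.affineBracket l l') ξ = 0 := by
  obtain ⟨x, ξ⟩ := ξ
  obtain ⟨s, rfl⟩ := exists_section_apply_eq (E := DualBundle E) I (F →L[ℝ] ℝ) x ξ
  obtain ⟨σ, u⟩ := l
  obtain ⟨τ, g⟩ := l'
  have hσ : σ x = 0 := apply_eq_zero_of_differential_affineFunction_eq_zero h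
  have hs : A.anchorAction τ ((linearFunction σ).comp (sectionMap s)) x =
      -A.anchorAction τ u x :=
    DFunLike.congr_fun (differential_comp_sectionMap_of_differential_affineFunction_eq_zero h)
      (A.anchor x (τ x))
  change s x (A.bracket σ τ x) + (A.anchorAction σ g x - A.anchorAction τ u x) = 0
  rw [A.bracket_skew, A.anchorAction_apply_eq_zero hσ, ContMDiffSection.coe_neg, Pi.neg_apply,
    map_neg, apply_bracket_eq_anchorAction_of_apply_eq_zero A hσ, hs]
  ring

theorem exists_poissonStructure_bracket_affineFunction :
    ∃ P : PoissonStructure (I.prod 𝓘(ℝ, F →L[ℝ] ℝ)) (TotalSpace (F →L[ℝ] ℝ) (DualBundle E)),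
      ∀ l l', P.bracket (affineFunction I F E l) (affineFunction I F E l') =
        affineFunction I F E (A.affineBracket l l') := by
  have : T2Space (TotalSpace (F →L[ℝ] ℝ) (DualBundle E)) := t2Space_totalSpace
  exact exists_poissonStructure (D := affineFunction I F E) (β := A.affineBracket)
    differentialsExhaust_affineFunction A.affineBracket_self
    (fun _ _ h ↦ A.affineFunction_affineBracket_apply_eq_zero h)
    fun l l' l'' ↦ by rw [A.affineBracket_jacobi, map_add]

variable {A} in
theorem isFiberwiseLinear_of_bracket_affineFunction
    {P : PoissonStructure (I.prod 𝓘(ℝ, F →L[ℝ] ℝ)) (TotalSpace (F →L[ℝ] ℝ) (DualBundle E))}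
    (hP : ∀ l l', P.bracket (affineFunction I F E l) (affineFunction I F E l') =
      affineFunction I F E (A.affineBracket l l')) : P.IsFiberwiseLinear I :=
  isFiberwiseLinear_of_bracket_comp_fiberScalingMap differentialsExhaust_affineFunction
    fun t _ ⟨σ, u⟩ ⟨τ, g⟩ ↦ by
      rw [affineFunction_comp_fiberScalingMap, affineFunction_comp_fiberScalingMap, hP, hP,
        affineFunction_affineBracket_fiberScaling]

end Existence

end LieAlgebroidStructure

namespace LieAlgebroidStructure

variable {EM : Type*} [NormedAddCommGroup EM] [NormedSpace ℝ EM]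
  {HM : Type*} [TopologicalSpace HM] {I : ModelWithCorners ℝ EM HM}
  {M : Type*} [TopologicalSpace M] [ChartedSpace HM M] [IsManifold I ∞ M] [I.Boundaryless]
  {F : Type*} [NormedAddCommGroup F] [NormedSpace ℝ F]
  {E : M → Type*} [TopologicalSpace (TotalSpace F E)]
  [∀ x, AddCommGroup (E x)] [∀ x, Module ℝ (E x)] [∀ x, TopologicalSpace (E x)]
  [FiberBundle F E] [VectorBundle ℝ F E] [ContMDiffVectorBundle ∞ F E I]
  [FiniteDimensional ℝ EM] [T2Space M]

namespace Induces

variable {A : LieAlgebroidStructure I F E}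
  {P : PoissonStructure (I.prod 𝓘(ℝ, F →L[ℝ] ℝ)) (TotalSpace (F →L[ℝ] ℝ) (DualBundle E))}

-- Both sides, multiplied by `φ_τ`, are what the two Leibniz rules contribute to
-- `{φ_σ, φ_(f τ)} = φ_[σ, f τ]` beyond `(p^* f) {φ_σ, φ_τ}`.
theorem bracket_linearFunction_basePullback (h : A.Induces P) (σ : Cₛ^∞⟮I; F, E⟯)
    (f : C^∞⟮I, M; 𝓘(ℝ), ℝ⟯) :
    P.bracket (linearFunction σ) (basePullback (F →L[ℝ] ℝ) (DualBundle E) f) =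
      basePullback (F →L[ℝ] ℝ) (DualBundle E) (A.anchorAction σ f) := by
  cases subsingleton_or_nontrivial F
  · have : ∀ x, Subsingleton (E x) := subsingleton_fiber F
    obtain rfl : σ = 0 := ContMDiffSection.ext fun x ↦ Subsingleton.elim _ _
    simp only [linearFunction_zero, map_zero, LinearMap.zero_apply]
  rw [← sub_eq_zero]
  refine eq_zero_of_mul_linearFunction_eq_zero fun τ ↦ ?_
  have hτ := h σ (ContMDiffSection.funSMul f τ)
  rw [linearFunction_funSMul, P.leibniz, h σ τ, bracket_funSMul,
    linearFunction_add, linearFunction_funSMul, linearFunction_funSMul] at hτ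
  linear_combination hτ

theorem bracket_basePullback_basePullback [Nontrivial F] (h : A.Induces P)
    (f g : C^∞⟮I, M; 𝓘(ℝ), ℝ⟯) :
    P.bracket (basePullback (F →L[ℝ] ℝ) (DualBundle E) f)
      (basePullback (F →L[ℝ] ℝ) (DualBundle E) g) = 0 := by
  refine eq_zero_of_mul_linearFunction_eq_zero fun τ ↦ ?_
  have hτ := h.bracket_linearFunction_basePullback (ContMDiffSection.funSMul f τ) g
  rw [linearFunction_funSMul, P.bracket_mul_left, h.bracket_linearFunction_basePullback,
    anchorAction_funSMul, map_mul] at hτ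
  linear_combination hτ

theorem bracket_affineFunction (h : A.Induces P)
    (hbase : ∀ f g, P.bracket (basePullback (F →L[ℝ] ℝ) (DualBundle E) f)
      (basePullback (F →L[ℝ] ℝ) (DualBundle E) g) = 0)
    (l l' : Cₛ^∞⟮I; F, E⟯ × C^∞⟮I, M; 𝓘(ℝ), ℝ⟯) :
    P.bracket (affineFunction I F E l) (affineFunction I F E l') =
      affineFunction I F E (A.affineBracket l l') := by
  obtain ⟨σ, f⟩ := l
  obtain ⟨τ, g⟩ := l'
  rw [affineBracket_apply, affineFunction_eq, affineFunction_eq, affineFunction_eq, map_add,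
    map_add, LinearMap.add_apply, LinearMap.add_apply, h, hbase,
    h.bracket_linearFunction_basePullback, P.skew (basePullback _ _ f),
    h.bracket_linearFunction_basePullback, map_sub]
  abel

end Induces

variable [FiniteDimensional ℝ F]

theorem Induces.bracket_basePullback_basePullback_of_finrank {A : LieAlgebroidStructure I F E}
    {P : PoissonStructure (I.prod 𝓘(ℝ, F →L[ℝ] ℝ)) (TotalSpace (F →L[ℝ] ℝ) (DualBundle E))}
    (h : A.Induces P) (hdim : 1 ≤ finrank ℝ F ∨ finrank ℝ EM ≤ 1) (f g : C^∞⟮I, M; 𝓘(ℝ), ℝ⟯) :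
    P.bracket (basePullback (F →L[ℝ] ℝ) (DualBundle E) f)
      (basePullback (F →L[ℝ] ℝ) (DualBundle E) g) = 0 := by
  cases subsingleton_or_nontrivial F
  · have : T2Space (TotalSpace (F →L[ℝ] ℝ) (DualBundle E)) := t2Space_totalSpace
    refine P.bracket_eq_zero_of_finrank_le_one ?_ _ _
    have hM : finrank ℝ EM ≤ 1 := by simpa [finrank_zero_of_subsingleton] using hdim
    rwa [finrank_prod, finrank_zero_of_subsingleton (M := F →L[ℝ] ℝ), add_zero]
  · exact h.bracket_basePullback_basePullback f g

theorem exists_linear_poissonStructure_unique (A : LieAlgebroidStructure I F E) :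
    ∃ P : PoissonStructure (I.prod 𝓘(ℝ, F →L[ℝ] ℝ)) (TotalSpace (F →L[ℝ] ℝ) (DualBundle E)),
      A.Induces P ∧ P.IsFiberwiseLinear I ∧
      (∀ Q, A.Induces Q → Q.IsFiberwiseLinear I → Q = P) ∧
      ((1 ≤ finrank ℝ F ∨ finrank ℝ EM ≤ 1) → ∀ Q, A.Induces Q → Q = P) := by
  have : T2Space (TotalSpace (F →L[ℝ] ℝ) (DualBundle E)) := t2Space_totalSpace
  obtain ⟨P, hP⟩ := A.exists_poissonStructure_bracket_affineFunction
  have huniq (Q : PoissonStructure (I.prod 𝓘(ℝ, F →L[ℝ] ℝ))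
      (TotalSpace (F →L[ℝ] ℝ) (DualBundle E))) (hQ : A.Induces Q)
      (hbase : ∀ f g, Q.bracket (basePullback (F →L[ℝ] ℝ) (DualBundle E) f)
        (basePullback (F →L[ℝ] ℝ) (DualBundle E) g) = 0) : Q = P :=
    PoissonStructure.eq_of_bracket_eq differentialsExhaust_affineFunction fun l l' ↦
      (hQ.bracket_affineFunction hbase l l').trans (hP l l').symm
  refine ⟨P, fun σ τ ↦ ?_, isFiberwiseLinear_of_bracket_affineFunction hP,
    fun Q hQ hlin ↦ huniq Q hQ hlin.bracket_basePullback_basePullback,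
    fun hdim Q hQ ↦ huniq Q hQ (hQ.bracket_basePullback_basePullback_of_finrank hdim)⟩
  have hστ := hP (σ, 0) (τ, 0)
  rwa [affineBracket_apply, map_zero, map_zero, sub_zero, affineFunction_inl, affineFunction_inl,
    affineFunction_inl] at hστ

end LieAlgebroidStructure

theorem fderiv_zero_apply_of_map_smul {X Y : Type*} [NormedAddCommGroup X]
    [NormedSpace ℝ X] [NormedAddCommGroup Y] [NormedSpace ℝ Y] {k : X → Y}
    (hk : DifferentiableAt ℝ k 0) (hsmul : ∀ (t : ℝ) w, k (t • w) = t • k w) (w : X) :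
    fderiv ℝ k 0 w = k w := by
  have hfderiv := hk.hasFDerivAt.hasLineDerivAt w
  have hline : HasLineDerivAt ℝ k (k w) 0 w := by
    simpa [HasLineDerivAt, hsmul] using (hasDerivAt_id (0 : ℝ)).smul_const (k w)
  exact hfderiv.unique hline

section LinearFunctionsOfDual

variable {EM : Type*} [NormedAddCommGroup EM] [NormedSpace ℝ EM]
  {HM : Type*} [TopologicalSpace HM] {I : ModelWithCorners ℝ EM HM}
  {M : Type*} [TopologicalSpace M] [ChartedSpace HM M]
  {F : Type*} [NormedAddCommGroup F] [NormedSpace ℝ F]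
  {V : M → Type*} [TopologicalSpace (TotalSpace F V)]
  [∀ x, AddCommGroup (V x)] [∀ x, Module ℝ (V x)] [∀ x, TopologicalSpace (V x)]
  [FiberBundle F V] [VectorBundle ℝ F V] [ContMDiffVectorBundle ∞ F V I]

variable (I F V) in
/-- The map `σ ↦ φ_σ`, from sections of `V*` to functions on the total space of `V`. -/
def linearFunctionOfDualₗ : Cₛ^∞⟮I; F →L[ℝ] ℝ, DualBundle V⟯ →ₗ[ℝ]
    C^∞⟮I.prod 𝓘(ℝ, F), TotalSpace F V; 𝓘(ℝ), ℝ⟯ where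
  toFun := linearFunctionOfDual
  map_add' _ _ := rfl
  map_smul' _ _ := rfl

theorem linearFunctionOfDualₗ_apply (σ : Cₛ^∞⟮I; F →L[ℝ] ℝ, DualBundle V⟯) :
    linearFunctionOfDualₗ I F V σ = linearFunctionOfDual σ := rfl

theorem linearFunctionOfDualₗ_injective : Function.Injective (linearFunctionOfDualₗ I F V) :=
  fun _ _ h ↦ ContMDiffSection.ext fun x ↦ ContinuousLinearMap.ext fun w ↦
    DFunLike.congr_fun h (⟨x, w⟩ : TotalSpace F V)

theorem linearFunctionOfDual_funSMul (f : C^∞⟮I, M; 𝓘(ℝ), ℝ⟯)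
    (σ : Cₛ^∞⟮I; F →L[ℝ] ℝ, DualBundle V⟯) :
    linearFunctionOfDual (ContMDiffSection.funSMul f σ) =
      basePullback F V f * linearFunctionOfDual σ := rfl

theorem isFiberwiseHomogeneous_linearFunctionOfDual (σ : Cₛ^∞⟮I; F →L[ℝ] ℝ, DualBundle V⟯) :
    IsFiberwiseHomogeneous 1 (linearFunctionOfDual σ) := fun t _ v ↦ by
  rw [zpow_one]
  exact map_smul (σ v.proj) t v.2

namespace IsFiberwiseHomogeneous

variable {f : C^∞⟮I.prod 𝓘(ℝ, F), TotalSpace F V; 𝓘(ℝ), ℝ⟯}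

theorem apply_eq_apply_zero (hf : IsFiberwiseHomogeneous 0 f) (v : TotalSpace F V) :
    f v = f ⟨v.proj, 0⟩ := by
  have h := apply_fiberScaling (n := 0) hf 0 v
  rw [pow_zero, one_mul] at h
  rw [← h, fiberScaling, zero_smul]

theorem exists_clm_apply_eq (hf : IsFiberwiseHomogeneous 1 f) (x : M) :
    ∃ s : V x →L[ℝ] ℝ, ∀ w : V x, s w = f ⟨x, w⟩ := by
  let e := (trivializationAt F V x).continuousLinearEquivAt ℝ x (mem_baseSet_trivializationAt F V x)
  let k : F → ℝ := fun w ↦ f ⟨x, e.symm w⟩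
  have hk : ContDiff ℝ ∞ k := (f.contMDiff.comp
    (contMDiff_mk_trivializationAt_symm (I := I) (E := V) x)).contDiff
  have hsmul (t : ℝ) (w : F) : k (t • w) = t • k w := by
    have h := apply_fiberScaling (n := 1) hf t ⟨x, e.symm w⟩
    rw [pow_one] at h
    simp only [k, map_smul]
    exact h
  refine ⟨(fderiv ℝ k 0).comp (e : V x →L[ℝ] F), fun w ↦ ?_⟩
  have hkw := fderiv_zero_apply_of_map_smul (hk.differentiable (by simp) 0) hsmul (e w)
  simp only [k, e.symm_apply_apply] at hkw
  exact hkw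

theorem exists_linearFunctionOfDual_eq [FiniteDimensional ℝ F] [FiniteDimensional ℝ EM]
    [T2Space M] [IsManifold I ∞ M] (hf : IsFiberwiseHomogeneous 1 f) :
    ∃ σ : Cₛ^∞⟮I; F →L[ℝ] ℝ, DualBundle V⟯, linearFunctionOfDual σ = f := by
  choose s hs using hf.exists_clm_apply_eq
  have hsmooth : ContMDiff I (I.prod 𝓘(ℝ, F →L[ℝ] ℝ)) ∞
      fun x ↦ TotalSpace.mk' (F →L[ℝ] ℝ) (E := DualBundle V) x (s x) := by
    refine contMDiff_hom_of_apply_section (E' := Bundle.Trivial M ℝ) fun τ x ↦ ?_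
    rw [contMDiffAt_section]
    exact ((f.contMDiff.comp τ.contMDiff).congr fun y ↦ hs y (τ y)) x
  exact ⟨⟨s, hsmooth⟩, ContMDiffMap.ext fun v ↦ hs v.proj v.2⟩

end IsFiberwiseHomogeneous

namespace PoissonStructure.IsFiberwiseLinear

variable {P : PoissonStructure (I.prod 𝓘(ℝ, F)) (TotalSpace F V)} (hP : P.IsFiberwiseLinear I)
include hP

theorem bracket_basePullback_apply (σ : Cₛ^∞⟮I; F →L[ℝ] ℝ, DualBundle V⟯)
    (f : C^∞⟮I, M; 𝓘(ℝ), ℝ⟯) (v : TotalSpace F V) :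
    P.bracket (linearFunctionOfDual σ) (basePullback F V f) v =
      P.bracket (linearFunctionOfDual σ) (basePullback F V f) ⟨v.proj, 0⟩ :=
  IsFiberwiseHomogeneous.apply_eq_apply_zero (.bracket hP
    (isFiberwiseHomogeneous_linearFunctionOfDual σ) (isFiberwiseHomogeneous_basePullback f)) v

theorem bracket_funSMul_basePullback (σ : Cₛ^∞⟮I; F →L[ℝ] ℝ, DualBundle V⟯)
    (f g : C^∞⟮I, M; 𝓘(ℝ), ℝ⟯) :
    P.bracket (linearFunctionOfDual (ContMDiffSection.funSMul f σ)) (basePullback F V g) =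
      basePullback F V f * P.bracket (linearFunctionOfDual σ) (basePullback F V g) := by
  rw [linearFunctionOfDual_funSMul, P.bracket_mul_left, hP.bracket_basePullback_basePullback,
    zero_mul, zero_add]

variable [FiniteDimensional ℝ EM] [T2Space M] [IsManifold I ∞ M] [FiniteDimensional ℝ F]

theorem exists_anchor [I.Boundaryless] :
    ∃ a : Cₛ^∞⟮I; (F →L[ℝ] ℝ) →L[ℝ] EM, fun x ↦ DualBundle V x →L[ℝ] TangentSpace I x⟯,
      ∀ σ f v, P.bracket (linearFunctionOfDual σ) (basePullback F V f) v =
        differential I f v.proj (a v.proj (σ v.proj)) := by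
  let zero : C^∞⟮I, M; I.prod 𝓘(ℝ, F), TotalSpace F V⟯ := ⟨_, contMDiff_zeroSection ℝ V⟩
  let B : Cₛ^∞⟮I; F →L[ℝ] ℝ, DualBundle V⟯ →ₗ[ℝ]
      Derivation ℝ C^∞⟮I, M; 𝓘(ℝ), ℝ⟯ C^∞⟮I, M; 𝓘(ℝ), ℝ⟯ :=
    { toFun σ := .mk'
        { toFun f := (P.bracket (linearFunctionOfDual σ) (basePullback F V f)).comp zero
          map_add' f g := by rw [map_add, map_add]; rfl
          map_smul' c f := by rw [map_smul, map_smul]; rfl }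
        fun f g ↦ ContMDiffMap.ext fun x ↦ by
          have h := DFunLike.congr_fun
            (P.leibniz (linearFunctionOfDual σ) (basePullback F V f) (basePullback F V g)) (zero x)
          exact h.trans ((add_comm _ _).trans (congrArg (_ + ·) (mul_comm _ _)))
      map_add' σ τ := Derivation.ext fun f ↦
        congrArg (·.comp zero) (LinearMap.map_add₂ P.bracket (linearFunctionOfDual σ)
          (linearFunctionOfDual τ) (basePullback F V f))
      map_smul' c σ := Derivation.ext fun f ↦
        congrArg (·.comp zero) (LinearMap.map_smul₂ P.bracket c (linearFunctionOfDual σ)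
          (basePullback F V f)) }
  have hB (f : C^∞⟮I, M; 𝓘(ℝ), ℝ⟯) (σ) : B (ContMDiffSection.funSMul f σ) = f • B σ :=
    Derivation.ext fun g ↦ congrArg (·.comp zero) (hP.bracket_funSMul_basePullback σ f g)
  obtain ⟨a, ha⟩ := exists_anchor_of_derivation B hB
  exact ⟨a, fun σ f v ↦ (hP.bracket_basePullback_apply σ f v).trans (ha σ f v.proj).symm⟩

theorem exists_sectionBracket :
    ∃ B : Cₛ^∞⟮I; F →L[ℝ] ℝ, DualBundle V⟯ →ₗ[ℝ] Cₛ^∞⟮I; F →L[ℝ] ℝ, DualBundle V⟯ →ₗ[ℝ]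
        Cₛ^∞⟮I; F →L[ℝ] ℝ, DualBundle V⟯,
      ∀ σ τ, P.bracket (linearFunctionOfDual σ) (linearFunctionOfDual τ) =
        linearFunctionOfDual (B σ τ) := by
  choose B hB using fun σ τ : Cₛ^∞⟮I; F →L[ℝ] ℝ, DualBundle V⟯ ↦
    IsFiberwiseHomogeneous.exists_linearFunctionOfDual_eq (.bracket hP
      (isFiberwiseHomogeneous_linearFunctionOfDual σ)
      (isFiberwiseHomogeneous_linearFunctionOfDual τ))
  let φ := linearFunctionOfDualₗ I F V
  replace hB (σ τ) : φ (B σ τ) = P.bracket (φ σ) (φ τ) := hB σ τ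
  refine ⟨LinearMap.mk₂ ℝ B (fun σ σ' τ ↦ ?_) (fun c σ τ ↦ ?_) (fun σ τ τ' ↦ ?_)
    (fun c σ τ ↦ ?_), fun σ τ ↦ (hB σ τ).symm⟩ <;>
  exact linearFunctionOfDualₗ_injective (by simp only [φ, map_add, map_smul, LinearMap.add_apply,
    LinearMap.smul_apply, hB])

theorem exists_lieAlgebroidStructure [I.Boundaryless] :
    ∃ A : LieAlgebroidStructure I (F →L[ℝ] ℝ) (DualBundle V), A.InducesOnPredual P := by
  obtain ⟨a, ha⟩ := hP.exists_anchor
  obtain ⟨B, hB⟩ := hP.exists_sectionBracket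
  refine ⟨⟨B, a, fun σ ↦ ?_, fun σ τ ρ ↦ ?_, fun σ τ f x ↦ ?_⟩, hB⟩
  · exact linearFunctionOfDualₗ_injective ((hB σ σ).symm.trans (P.bracket_self _))
  · apply linearFunctionOfDualₗ_injective
    simp only [map_add, linearFunctionOfDualₗ_apply, ← hB]
    exact P.jacobi _ _ _
  · ext w
    have hw := DFunLike.congr_fun (hB σ (ContMDiffSection.funSMul f τ)) (⟨x, w⟩ : TotalSpace F V)
    rw [linearFunctionOfDual_funSMul, P.leibniz, hB] at hw
    refine hw.symm.trans ?_
    change P.bracket (linearFunctionOfDual σ) (basePullback F V f) ⟨x, w⟩ * τ x w +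
      f x * B σ τ x w = f x * B σ τ x w + differential I f x (a x (σ x)) * τ x w
    rw [ha, add_comm]

end PoissonStructure.IsFiberwiseLinear

end LinearFunctionsOfDual

theorem LieAlgebroidStructure.eq_of_bracket_eq
    {EM : Type*} [NormedAddCommGroup EM] [NormedSpace ℝ EM] [FiniteDimensional ℝ EM]
    {HM : Type*} [TopologicalSpace HM] {I : ModelWithCorners ℝ EM HM} [I.Boundaryless]
    {M : Type*} [TopologicalSpace M] [ChartedSpace HM M] [IsManifold I ∞ M] [T2Space M]
    {F : Type*} [NormedAddCommGroup F] [NormedSpace ℝ F]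
    {E : M → Type*} [TopologicalSpace (TotalSpace F E)]
    [∀ x, AddCommGroup (E x)] [∀ x, Module ℝ (E x)] [∀ x, TopologicalSpace (E x)]
    [FiberBundle F E] [VectorBundle ℝ F E] [ContMDiffVectorBundle ∞ F E I]
    {A A' : LieAlgebroidStructure I F E} (h : A.bracket = A'.bracket) : A = A' := by
  refine LieAlgebroidStructure.ext h ?_
  ext x β
  obtain ⟨σ, rfl⟩ := exists_section_apply_eq I F x β
  by_cases hσ : σ x = 0
  · rw [hσ, map_zero, map_zero]
  · refine eq_of_differential_apply_eq fun f ↦ ?_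
    have hleibniz := A.leibniz σ σ f x
    rw [h, A'.leibniz σ σ f x, add_right_inj] at hleibniz
    exact (smul_left_injective ℝ hσ hleibniz).symm

theorem PoissonStructure.IsFiberwiseLinear.existsUnique_lieAlgebroidStructure
    {EM : Type*} [NormedAddCommGroup EM] [NormedSpace ℝ EM] [FiniteDimensional ℝ EM]
    {HM : Type*} [TopologicalSpace HM] {I : ModelWithCorners ℝ EM HM} [I.Boundaryless]
    {M : Type*} [TopologicalSpace M] [ChartedSpace HM M] [IsManifold I ∞ M] [T2Space M]
    {F : Type*} [NormedAddCommGroup F] [NormedSpace ℝ F] [FiniteDimensional ℝ F]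
    {V : M → Type*} [TopologicalSpace (TotalSpace F V)]
    [∀ x, AddCommGroup (V x)] [∀ x, Module ℝ (V x)] [∀ x, TopologicalSpace (V x)]
    [FiberBundle F V] [VectorBundle ℝ F V] [ContMDiffVectorBundle ∞ F V I]
    {P : PoissonStructure (I.prod 𝓘(ℝ, F)) (TotalSpace F V)} (hP : P.IsFiberwiseLinear I) :
    ∃! A : LieAlgebroidStructure I (F →L[ℝ] ℝ) (DualBundle V), A.InducesOnPredual P := by
  obtain ⟨A, hA⟩ := hP.exists_lieAlgebroidStructure
  refine ⟨A, hA, fun A' hA' ↦ LieAlgebroidStructure.eq_of_bracket_eq ?_⟩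
  exact LinearMap.ext₂ fun σ τ ↦
    linearFunctionOfDualₗ_injective ((hA' σ τ).symm.trans (hA σ τ))

end

theorem mainTheorem8_general
    {EM : Type*} [NormedAddCommGroup EM] [NormedSpace ℝ EM] [FiniteDimensional ℝ EM]
    {HM : Type*} [TopologicalSpace HM] (I : ModelWithCorners ℝ EM HM) [I.Boundaryless]
    {M : Type*} [TopologicalSpace M] [ChartedSpace HM M] [IsManifold I ∞ M]
    [T2Space M] :
    (∀ {F : Type*} [NormedAddCommGroup F] [NormedSpace ℝ F] [FiniteDimensional ℝ F]
      {E : M → Type*} [TopologicalSpace (TotalSpace F E)]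
      [∀ x, AddCommGroup (E x)] [∀ x, Module ℝ (E x)] [∀ x, TopologicalSpace (E x)]
      [FiberBundle F E] [VectorBundle ℝ F E] [ContMDiffVectorBundle ∞ F E I]
      (A : LieAlgebroidStructure I F E),
      ∃ P : PoissonStructure (I.prod 𝓘(ℝ, F →L[ℝ] ℝ)) (TotalSpace (F →L[ℝ] ℝ) (DualBundle E)),
        A.Induces P ∧ P.IsFiberwiseLinear I ∧
        (∀ Q, A.Induces Q → Q.IsFiberwiseLinear I → Q = P) ∧
        ((1 ≤ finrank ℝ F ∨ finrank ℝ EM ≤ 1) → ∀ Q, A.Induces Q → Q = P)) ∧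
    (∀ {F : Type*} [NormedAddCommGroup F] [NormedSpace ℝ F] [FiniteDimensional ℝ F]
      {V : M → Type*} [TopologicalSpace (TotalSpace F V)]
      [∀ x, AddCommGroup (V x)] [∀ x, Module ℝ (V x)] [∀ x, TopologicalSpace (V x)]
      [FiberBundle F V] [VectorBundle ℝ F V] [ContMDiffVectorBundle ∞ F V I]
      (P : PoissonStructure (I.prod 𝓘(ℝ, F)) (TotalSpace F V)),
      P.IsFiberwiseLinear I →
        ∃! A : LieAlgebroidStructure I (F →L[ℝ] ℝ) (DualBundle V), A.InducesOnPredual P) :=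
  ⟨fun A ↦ A.exists_linear_poissonStructure_unique,
    fun _ hP ↦ hP.existsUnique_lieAlgebroidStructure⟩

theorem mainTheorem8
    {EM : Type*} [NormedAddCommGroup EM] [NormedSpace ℝ EM] [FiniteDimensional ℝ EM]
    {HM : Type*} [TopologicalSpace HM] (I : ModelWithCorners ℝ EM HM) [I.Boundaryless]
    {M : Type*} [TopologicalSpace M] [ChartedSpace HM M] [IsManifold I ∞ M]
    [T2Space M] [SigmaCompactSpace M] :
    -- every Lie algebroid `E → M` induces a linear Poisson structure on `E*`
    (∀ {F : Type*} [NormedAddCommGroup F] [NormedSpace ℝ F] [FiniteDimensional ℝ F]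
      {E : M → Type*} [TopologicalSpace (TotalSpace F E)]
      [∀ x, AddCommGroup (E x)] [∀ x, Module ℝ (E x)] [∀ x, TopologicalSpace (E x)]
      [FiberBundle F E] [VectorBundle ℝ F E] [ContMDiffVectorBundle ∞ F E I]
      (A : LieAlgebroidStructure I F E),
      ∃ P : PoissonStructure (I.prod 𝓘(ℝ, F →L[ℝ] ℝ)) (TotalSpace (F →L[ℝ] ℝ) (DualBundle E)),
        A.Induces P ∧ P.IsFiberwiseLinear I ∧
        (∀ Q, A.Induces Q → Q.IsFiberwiseLinear I → Q = P) ∧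
        ((1 ≤ finrank ℝ F ∨ finrank ℝ EM ≤ 1) → ∀ Q, A.Induces Q → Q = P)) ∧
    -- every linear Poisson structure on `V` arises from a unique Lie algebroid structure on `V*`
    (∀ {F : Type*} [NormedAddCommGroup F] [NormedSpace ℝ F] [FiniteDimensional ℝ F]
      {V : M → Type*} [TopologicalSpace (TotalSpace F V)]
      [∀ x, AddCommGroup (V x)] [∀ x, Module ℝ (V x)] [∀ x, TopologicalSpace (V x)]
      [FiberBundle F V] [VectorBundle ℝ F V] [ContMDiffVectorBundle ∞ F V I]
      (P : PoissonStructure (I.prod 𝓘(ℝ, F)) (TotalSpace F V)),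
      P.IsFiberwiseLinear I →
        ∃! A : LieAlgebroidStructure I (F →L[ℝ] ℝ) (DualBundle V), A.InducesOnPredual P) :=
  mainTheorem8_general I
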